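/- **Setting.** Let $\nu_1$ be a $\sigma$-finite measure on $\mathbb R^p$, $\nu=\nu_1\times\text{Lebesgue}$ on $\mathbb R^p\times\mathbb R^d$, and let $\mathcal Q$ be an arbitrary class of probability densities $q$ with respect to $\nu$ (densities of the covariates $(X,Z)$). Let $\mathcal G$ be the class of symmetric, absolutely continuous probability densities $g$ on $\mathbb R$ with $I_g=\int (g')^2/g<\infty$. For $q\in\mathcal Q$ let $\mathcal H(q)$ be the set of additive functions $m(z)=m_1(z_1)+\dots+m_d(z_d)$ with $E_q m(Z)^2<\infty$ and $E_q m_j(Z_j)=0$ for all $j$. The partially linear additive model $Y=X^\top\beta+m(Z)+\varepsilon$, with $\varepsilon$ independent of $(X,Z)$, is $$\mathcal P=\{\,p(x,z,y)=q(x,z)\,g(y-x^\top\beta-m(z)) : \beta\in\mathbb R^p,\ m\in\mathcal H(q),\ g\in\mathcal G,\ q\in\mathcal Q\,\}.$$ Fix a point $(\beta^0,m^0,g_0,q_0)$ of the model, with law $P_0$, expectation $E_0$ and density $p_0$, and assume $E_0|X|^2<\infty$. A *regular parametric submodel* through $P_0$ is a family $\theta\mapsto(\beta_\theta,m_\theta,g_\theta,q_\theta)$,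 $\theta\in\mathbb R^k$, equal to $(\beta^0,m^0,g_0,q_0)$ at $\theta_0$ and lying in $\mathcal P$ for $\theta$ near $\theta_0$, such that $\theta\mapsto\beta_\theta$ is differentiable at $\theta_0$ (with derivative $B$), $m_\theta\in\mathcal H(q_0)$ for $\theta$ near $\theta_0$ and $\theta\mapsto m_\theta\in\mathcal H(q_0)$ is Fréchet differentiable at $\theta_0$ in the $L_2(q_0)$ norm, with derivative in $\mathcal H(q_0)$, and the density is differentiable in quadratic mean at $\theta_0$: $\sqrt{p_\theta}=\sqrt{p_0}+\tfrac12\sum_i(\theta-\theta_0)_i s_i\sqrt{p_0}+o(|\theta-\theta_0|)$ in $L_2$, with score vector $s\in L_2(P_0)^k$ and information matrix $E_0[ss^\top]$. It is *indexed by $\beta$ only* if $k=p$, $\theta_0=\beta^0$ and $\beta_\theta=\theta$. A submodel indexed by $\beta$ only is *least favorable* if its information matrix is the smallest (in the Loewner order) among all of these. The *nuisance tangent space* is the closed linear span in $L_2(P_0)$ of the scores of one-dimensional regular submodels with $\beta_\theta\equiv\beta^0$. Let $\eta_j$ be the $L_2$ projection of $E_0(X_j\mid Z=\cdot)$ onto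 $\mathcal H(q_0)$ (onto its closure, if $\mathcal H(q_0)$ is not closed in $L_2$), and $\eta=(\eta_1,\dots,\eta_p)^\top$. **Theorem.** The efficient score at $P_0$ for estimating $\beta$ is $$\ell^*(x,z,y)=-[x-\eta(z)]\,\frac{g_0'}{g_0}\bigl(y-x^\top\beta^0-m^0(z)\bigr).$$ That is: $\ell^*$ is the score for $\beta$ in the submodel $\{(\beta,m^0,g_0,q_0)\}$ minus its projection onto the nuisance tangent space; the score of every least favorable submodel equals $\ell^*$ $P_0$-a.s.; and a least favorable submodel exists whenever $\eta_1,\dots,\eta_p\in\mathcal H(q_0)$, in particular whenever $\mathcal H(q_0)$ is closed, i.e. a Hilbert space. The semiparametric information bound at $P_0$ for estimating $\beta$ is $$I(P_0\mid\beta,\mathcal P)=I_{g_0}\cdot E_0\bigl[(X-\eta(Z))(X-\eta(Z))^\top\bigr].$$ That is: this matrix is the greatest lower bound, in the Loewner order, of the information matrices of the regular submodels indexed by $\beta$ only; and if it is positive definite, its inverse is the least upper bound of the matrices $B\,(E_0[ss^\top])^{-1}B^\top$ over all regular finite-dimensional submodels through $P_0$ with nonsingular $E_0[ss^\top]$. 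-/

import Mathlib

open MeasureTheory Filter Topology Asymptotics
open scoped ENNReal MatrixOrder

noncomputable section

/-- Parameters `(β, m, g, q)` of the model `Y = Xᵀβ + m(Z) + ε`: regression vector, nonparametric
regression function, error density, and density of the covariates `(X, Z)`. -/
structure Params (p d : ℕ) where
  beta : Fin p → ℝ
  m : (Fin d → ℝ) → ℝ
  g : ℝ → ℝ
  q : (Fin p → ℝ) × (Fin d → ℝ) → ℝ

/-- `f` is a probability density with respect to `ν`. -/
structure IsDensity {α : Type*} [MeasurableSpace α] (ν : Measure α) (f : α → ℝ) : Prop where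
  measurable : Measurable f
  nonneg : ∀ a, 0 ≤ f a
  lintegral_eq_one : ∫⁻ a, ENNReal.ofReal (f a) ∂ν = 1

/-- The Fisher information for location, `I_g = ∫ (g')² / g`. -/
def fisherInfo (g : ℝ → ℝ) : ℝ := ∫ e, (deriv g e) ^ 2 / g e

/-- The class of symmetric, absolutely continuous error densities with finite Fisher
information. -/
structure IsErrorDensity (g : ℝ → ℝ) : Prop where
  isDensity : IsDensity (volume : Measure ℝ) g
  symm : ∀ e, g (-e) = g e
  absolutelyContinuous : ∀ a b, AbsolutelyContinuousOnInterval g a b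
  finite_info : Integrable (fun e => (deriv g e) ^ 2 / g e)

/-- Reference measure `ν = ν₁ × Lebesgue` for the covariates `(X, Z)`. -/
def covRef {p : ℕ} (d : ℕ) (ν₁ : Measure (Fin p → ℝ)) :
    Measure ((Fin p → ℝ) × (Fin d → ℝ)) :=
  ν₁.prod volume

/-- Law of `(X, Z)` under the density `q`. -/
def covLaw {p d : ℕ} (ν₁ : Measure (Fin p → ℝ)) (q : (Fin p → ℝ) × (Fin d → ℝ) → ℝ) :
    Measure ((Fin p → ℝ) × (Fin d → ℝ)) :=
  (covRef d ν₁).withDensity fun w => ENNReal.ofReal (q w)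

/-- Law of `Z` under the density `q`. -/
def zLaw {p d : ℕ} (ν₁ : Measure (Fin p → ℝ)) (q : (Fin p → ℝ) × (Fin d → ℝ) → ℝ) :
    Measure (Fin d → ℝ) :=
  (covLaw ν₁ q).map Prod.snd

/-- `m ∈ H(q)`: `m(z) = m₁(z₁) + ⋯ + m_d(z_d)` with `E_q m_j(Z_j) = 0` for all `j` and
`E_q m(Z)² < ∞`. -/
def IsAdditive {p d : ℕ} (ν₁ : Measure (Fin p → ℝ)) (q : (Fin p → ℝ) × (Fin d → ℝ) → ℝ)
    (m : (Fin d → ℝ) → ℝ) : Prop :=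
  MemLp m 2 (zLaw ν₁ q) ∧
    ∃ c : Fin d → ℝ → ℝ, (∀ j, Measurable (c j)) ∧ (∀ z, m z = ∑ j, c j (z j)) ∧
      ∀ j, Integrable (fun z : Fin d → ℝ => c j (z j)) (zLaw ν₁ q) ∧
        ∫ z, c j (z j) ∂(zLaw ν₁ q) = 0

/-- `H(q)` as a subspace of `L₂` of the law of `Z`. -/
def additiveSpace {p d : ℕ} (ν₁ : Measure (Fin p → ℝ))
    (q : (Fin p → ℝ) × (Fin d → ℝ) → ℝ) : Submodule ℝ (Lp ℝ 2 (zLaw ν₁ q)) where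
  carrier := {f | ∃ m, IsAdditive ν₁ q m ∧ f =ᵐ[zLaw ν₁ q] m}
  zero_mem' := ⟨fun _ => 0, ⟨MemLp.zero', fun _ _ => 0, fun _ => measurable_const, by simp,
    fun _ => by simp⟩, Lp.coeFn_zero _ _ _⟩
  add_mem' := by
    rintro f f' ⟨m, ⟨hm, c, hc, hs, hi⟩, hf⟩ ⟨m', ⟨hm', c', hc', hs', hi'⟩, hf'⟩
    refine ⟨m + m', ⟨hm.add hm', fun j t => c j t + c' j t, fun j => (hc j).add (hc' j),
      fun z => by simp [hs, hs', Finset.sum_add_distrib],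
      fun j => ⟨(hi j).1.add (hi' j).1, ?_⟩⟩, (Lp.coeFn_add f f').trans (hf.add hf')⟩
    rw [integral_add (hi j).1 (hi' j).1, (hi j).2, (hi' j).2, add_zero]
  smul_mem' := by
    rintro a f ⟨m, ⟨hm, c, hc, hs, hi⟩, hf⟩
    refine ⟨a • m, ⟨hm.const_smul a, fun j t => a * c j t, fun j => (hc j).const_mul a,
      fun z => by simp [hs, Finset.mul_sum],
      fun j => ⟨(hi j).1.const_mul a, ?_⟩⟩, (Lp.coeFn_smul a f).trans (hf.const_smul a)⟩
    rw [integral_const_mul, (hi j).2, mul_zero]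

/-- Reference measure `ν × Lebesgue` for the observation `((X, Z), Y)`. -/
def obsRef {p : ℕ} (d : ℕ) (ν₁ : Measure (Fin p → ℝ)) :
    Measure (((Fin p → ℝ) × (Fin d → ℝ)) × ℝ) :=
  (covRef d ν₁).prod volume

/-- The residual `y - xᵀβ - m(z)`. -/
def Params.resid {p d : ℕ} (P : Params p d) (w : ((Fin p → ℝ) × (Fin d → ℝ)) × ℝ) : ℝ :=
  w.2 - w.1.1 ⬝ᵥ P.beta - P.m w.1.2

/-- The joint density `q(x, z) g(y - xᵀβ - m(z))` of the observation. -/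
def Params.density {p d : ℕ} (P : Params p d) (w : ((Fin p → ℝ) × (Fin d → ℝ)) × ℝ) : ℝ :=
  P.q w.1 * P.g (P.resid w)

/-- The law of the observation `((X, Z), Y)`. -/
def Params.law {p d : ℕ} (ν₁ : Measure (Fin p → ℝ)) (P : Params p d) :
    Measure (((Fin p → ℝ) × (Fin d → ℝ)) × ℝ) :=
  (obsRef d ν₁).withDensity fun w => ENNReal.ofReal (P.density w)

/-- The partially linear additive model, with covariate densities in the class `𝒬`. -/
def model {p d : ℕ} (ν₁ : Measure (Fin p → ℝ)) (𝒬 : Set ((Fin p → ℝ) × (Fin d → ℝ) → ℝ)) :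
    Set (Params p d) :=
  {P | P.q ∈ 𝒬 ∧ IsErrorDensity P.g ∧ IsAdditive ν₁ P.q P.m}

/-- A regular `k`-dimensional parametric submodel of the model, passing through `P₀` at
`θ₀`, with derivative `B` of `θ ↦ β(θ)` and score `s` at `θ₀`: near `θ₀` it stays in the model,
`θ ↦ m_θ` is a map into `H(q₀)` which is Fréchet differentiable at `θ₀`, and the root density is
differentiable in quadratic mean, `√p_θ = √p₀ + ½ ∑ᵢ (θ - θ₀)ᵢ sᵢ √p₀ + o(|θ - θ₀|)`. -/
structure IsRegularSubmodel {p d k : ℕ} (ν₁ : Measure (Fin p → ℝ))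
    (𝒬 : Set ((Fin p → ℝ) × (Fin d → ℝ) → ℝ)) (P₀ : Params p d) (θ₀ : Fin k → ℝ)
    (P : (Fin k → ℝ) → Params p d) (B : Matrix (Fin p) (Fin k) ℝ)
    (s : Fin k → Lp ℝ 2 (P₀.law ν₁)) : Prop where
  through : P θ₀ = P₀
  mem_model : ∀ᶠ θ in 𝓝 θ₀, P θ ∈ model ν₁ 𝒬
  mem_additive : ∀ᶠ θ in 𝓝 θ₀, IsAdditive ν₁ P₀.q (P θ).m
  beta_diff : HasFDerivAt (fun θ => (P θ).beta) (Matrix.toLin' B).toContinuousLinearMap θ₀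
  m_diff : ∃ δ : Fin k → (Fin d → ℝ) → ℝ, (∀ i, IsAdditive ν₁ P₀.q (δ i)) ∧
    (fun θ => (eLpNorm (fun z => (P θ).m z - P₀.m z - ∑ i, (θ i - θ₀ i) * δ i z) 2
      (zLaw ν₁ P₀.q)).toReal) =o[𝓝 θ₀] fun θ => θ - θ₀
  score : (fun θ => (eLpNorm (fun w => √((P θ).density w) - √(P₀.density w)
      - 1 / 2 * ∑ i, (θ i - θ₀ i) * (s i w * √(P₀.density w))) 2
      (obsRef d ν₁)).toReal) =o[𝓝 θ₀] fun θ => θ - θ₀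

/-- The Fisher information matrix `E₀ [s sᵀ]` of a score vector `s`. -/
def infoMatrix {p d k : ℕ} {ν₁ : Measure (Fin p → ℝ)} {P₀ : Params p d}
    (s : Fin k → Lp ℝ 2 (P₀.law ν₁)) : Matrix (Fin k) (Fin k) ℝ :=
  Matrix.of fun i j => ∫ w, s i w * s j w ∂(P₀.law ν₁)

/-- A regular parametric submodel through `P₀` which is indexed by `β` only. -/
def IsBetaSubmodel {p d : ℕ} (ν₁ : Measure (Fin p → ℝ))
    (𝒬 : Set ((Fin p → ℝ) × (Fin d → ℝ) → ℝ)) (P₀ : Params p d)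
    (P : (Fin p → ℝ) → Params p d) (s : Fin p → Lp ℝ 2 (P₀.law ν₁)) : Prop :=
  (∀ b, (P b).beta = b) ∧ IsRegularSubmodel ν₁ 𝒬 P₀ P₀.beta P 1 s

/-- The set of Fisher information matrices for `β` in the regular submodels indexed by `β`. -/
def betaInfos {p d : ℕ} (ν₁ : Measure (Fin p → ℝ))
    (𝒬 : Set ((Fin p → ℝ) × (Fin d → ℝ) → ℝ)) (P₀ : Params p d) :
    Set (Matrix (Fin p) (Fin p) ℝ) :=
  {M | ∃ P s, IsBetaSubmodel ν₁ 𝒬 P₀ P s ∧ M = infoMatrix s}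

/-- The set of inverse informations `β̇ I(θ₀)⁻¹ β̇ᵀ` for `β` in all regular finite-dimensional
submodels with nonsingular information matrix `I(θ₀)`. -/
def inverseInfos {p d : ℕ} (ν₁ : Measure (Fin p → ℝ))
    (𝒬 : Set ((Fin p → ℝ) × (Fin d → ℝ) → ℝ)) (P₀ : Params p d) :
    Set (Matrix (Fin p) (Fin p) ℝ) :=
  {M | ∃ (k : ℕ) (θ₀ : Fin k → ℝ) (P : (Fin k → ℝ) → Params p d)
    (B : Matrix (Fin p) (Fin k) ℝ) (s : Fin k → Lp ℝ 2 (P₀.law ν₁)),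
    IsRegularSubmodel ν₁ 𝒬 P₀ θ₀ P B s ∧ IsUnit (infoMatrix s).det ∧
      M = B * (infoMatrix s)⁻¹ * B.transpose}

/-- A least favorable submodel: indexed by `β` only, with the smallest information matrix (in the
Loewner order). -/
def IsLeastFavorable {p d : ℕ} (ν₁ : Measure (Fin p → ℝ))
    (𝒬 : Set ((Fin p → ℝ) × (Fin d → ℝ) → ℝ)) (P₀ : Params p d)
    (P : (Fin p → ℝ) → Params p d) (s : Fin p → Lp ℝ 2 (P₀.law ν₁)) : Prop :=
  IsBetaSubmodel ν₁ 𝒬 P₀ P s ∧ IsLeast (betaInfos ν₁ 𝒬 P₀) (infoMatrix s)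

/-- The nuisance tangent space: closed linear span of the scores of all regular one-dimensional
submodels along which `β` is constant. -/
def nuisanceTangentSpace {p d : ℕ} (ν₁ : Measure (Fin p → ℝ))
    (𝒬 : Set ((Fin p → ℝ) × (Fin d → ℝ) → ℝ)) (P₀ : Params p d) :
    Submodule ℝ (Lp ℝ 2 (P₀.law ν₁)) :=
  (Submodule.span ℝ {h | ∃ (P : (Fin 1 → ℝ) → Params p d) (s : Fin 1 → Lp ℝ 2 (P₀.law ν₁)),
    (∀ t, (P t).beta = P₀.beta) ∧ IsRegularSubmodel ν₁ 𝒬 P₀ 0 P 0 s ∧ h = s 0}).topologicalClosure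

instance {p d : ℕ} (ν₁ : Measure (Fin p → ℝ)) (𝒬 : Set ((Fin p → ℝ) × (Fin d → ℝ) → ℝ))
    (P₀ : Params p d) : CompleteSpace (nuisanceTangentSpace ν₁ 𝒬 P₀) :=
  (Submodule.isClosed_topologicalClosure _).completeSpace_coe

/-- `l` is the efficient score for `β` at `P₀`: the score for `β` with all nuisance parameters
held fixed, minus its projection onto the nuisance tangent space. -/
def IsEfficientScore {p d : ℕ} (ν₁ : Measure (Fin p → ℝ))
    (𝒬 : Set ((Fin p → ℝ) × (Fin d → ℝ) → ℝ)) (P₀ : Params p d)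
    (l : Fin p → ((Fin p → ℝ) × (Fin d → ℝ)) × ℝ → ℝ) : Prop :=
  ∃ s : Fin p → Lp ℝ 2 (P₀.law ν₁),
    IsBetaSubmodel ν₁ 𝒬 P₀ (fun b => { P₀ with beta := b }) s ∧
    ∀ j, l j =ᵐ[P₀.law ν₁] (s j - (nuisanceTangentSpace ν₁ 𝒬 P₀).starProjection (s j) :
      Lp ℝ 2 (P₀.law ν₁))

theorem exists_regression {p d : ℕ} (ν₁ : Measure (Fin p → ℝ))
    (q : (Fin p → ℝ) × (Fin d → ℝ) → ℝ) (j : Fin p) :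
    ∃ r : (Fin d → ℝ) → ℝ, Measurable r ∧
      (covLaw ν₁ q)[fun w => w.1 j | MeasurableSpace.comap Prod.snd inferInstance]
        = r ∘ Prod.snd := by
  obtain ⟨r, hr, h⟩ := Measurable.exists_eq_measurable_comp
    (f := (Prod.snd : (Fin p → ℝ) × (Fin d → ℝ) → Fin d → ℝ))
    (stronglyMeasurable_condExp (μ := covLaw ν₁ q) (f := fun w => w.1 j)
      (m := MeasurableSpace.comap Prod.snd inferInstance)).measurable
  exact ⟨r, hr, h⟩

/-- The regression function `E_q(X_j | Z = ·)`: the function `r` of `z` for which `r(Z)` is the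
conditional expectation of `X_j` given `Z`. -/
def regression {p d : ℕ} (ν₁ : Measure (Fin p → ℝ)) (q : (Fin p → ℝ) × (Fin d → ℝ) → ℝ)
    (j : Fin p) : (Fin d → ℝ) → ℝ :=
  (exists_regression ν₁ q j).choose

theorem memLp_regression {p d : ℕ} {ν₁ : Measure (Fin p → ℝ)}
    {q : (Fin p → ℝ) × (Fin d → ℝ) → ℝ}
    {j : Fin p} (hX : MemLp (fun w : (Fin p → ℝ) × (Fin d → ℝ) => w.1 j) 2 (covLaw ν₁ q)) :
    MemLp (regression ν₁ q j) 2 (zLaw ν₁ q) := by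
  obtain ⟨hr, h⟩ := (exists_regression ν₁ q j).choose_spec
  refine (memLp_map_measure_iff hr.aestronglyMeasurable measurable_snd.aemeasurable).2 ?_
  have h2 := hX.condExp (m := MeasurableSpace.comap Prod.snd inferInstance) one_le_two
  rw [h] at h2
  exact h2

/-- `η_j`, the `L₂` projection of `E_q(X_j | Z = ·)` onto (the closure of) `H(q)`. The closure
makes no difference when `H(q)` is a Hilbert space; otherwise the projection onto `H(q)` itself
need not exist. -/
def eta {p d : ℕ} {ν₁ : Measure (Fin p → ℝ)} {q : (Fin p → ℝ) × (Fin d → ℝ) → ℝ}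
    (hX : ∀ j, MemLp (fun w : (Fin p → ℝ) × (Fin d → ℝ) => w.1 j) 2 (covLaw ν₁ q))
    (j : Fin p) : Lp ℝ 2 (zLaw ν₁ q) :=
  haveI : CompleteSpace (additiveSpace ν₁ q).topologicalClosure :=
    (Submodule.isClosed_topologicalClosure _).completeSpace_coe
  (additiveSpace ν₁ q).topologicalClosure.starProjection ((memLp_regression (hX j)).toLp _)

/-- The function `-[x_j - η_j(z)] (g₀'/g₀)(y - xᵀβ⁰ - m⁰(z))`. -/
def effScore {p d : ℕ} {ν₁ : Measure (Fin p → ℝ)} (P₀ : Params p d)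
    (hX : ∀ j, MemLp (fun w : (Fin p → ℝ) × (Fin d → ℝ) => w.1 j) 2 (covLaw ν₁ P₀.q))
    (j : Fin p) (w : ((Fin p → ℝ) × (Fin d → ℝ)) × ℝ) : ℝ :=
  -(w.1.1 j - eta hX j w.1.2) * (deriv P₀.g (P₀.resid w) / P₀.g (P₀.resid w))

/-- The matrix `I_{g₀} · E₀ [X - η(Z)] [X - η(Z)]ᵀ`. -/
def infoBound {p d : ℕ} {ν₁ : Measure (Fin p → ℝ)} (P₀ : Params p d)
    (hX : ∀ j, MemLp (fun w : (Fin p → ℝ) × (Fin d → ℝ) => w.1 j) 2 (covLaw ν₁ P₀.q)) :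
    Matrix (Fin p) (Fin p) ℝ :=
  fisherInfo P₀.g • Matrix.of fun i j =>
    ∫ w, (w.1.1 i - eta hX i w.1.2) * (w.1.1 j - eta hX j w.1.2) ∂(P₀.law ν₁)

end

/-! ### The root density of the errors -/

/-! Write μ_θ(x, z) = xᵀβ_θ + m_θ(z). Along a submodel nothing is assumed about how g_θ and q_θ vary
beyond differentiability in quadratic mean, so the score cannot be computed by the chain rule.
Symmetry of g_θ replaces the computation: p_θ is invariant under the reflection R_θ : y ↦ 2μ_θ(x, z)
− y, which preserves the reference measure. Testing √p_θ − √p₀ against G − G∘R_θ and changing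
variables removes p_θ and leaves √p₀∘R_θ − √p₀ tested against G, that is, a shift of √g₀ by 2(μ_θ −
μ₀). In the limit, for G odd in the residual, the score s_i satisfies ⟨s_i, −b g₀'/g₀⟩ = I_{g₀}
E₀[μ̇_i b], as if the mean alone had moved (`integral_score_eq_of_reflection`,
`IsRegularSubmodel.integral_score_mul_shiftScore`). Shifts of √g₀ are differentiable in L² because
√g₀ is the integral of an L² function (`IsErrorDensity.sqrt_sub_sqrt`, `exists_shift_modulus`,
`isLittleOL2_shift`).

Here μ̇_i = ∑_l x_l B_{li} + δ_i(z) with δ_i ∈ H(q₀). Take b = X_j − η_j(Z), which is orthogonal to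
the closure of H(q₀): then δ_i drops out, X_l may be replaced by X_l − η_l(Z), and ⟨s_i, ℓ*_j⟩ = ∑_l
B_{li} ⟨ℓ*_l, ℓ*_j⟩ (`IsRegularSubmodel.inner_effScoreLp`). This identity carries all the upper and
lower bounds. For B = 0 it says that ℓ* is orthogonal to the nuisance scores; for B = 1 it makes the
information matrix exceed that of ℓ* by the Gram matrix of s − ℓ*; for general B it gives the
Cramér–Rao inequality.

Conversely, fixing g₀ and q₀ and moving the mean linearly gives regular submodels
(`isRegularSubmodel_of_linear`). They realise the scores of X_j − h_j(Z) for all h_j ∈ H(q₀). The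
map from mean perturbations to scores is √I_{g₀} times an isometry, so letting h_j tend to η_j
approximates ℓ*, and reaches it when η_j ∈ H(q₀). -/

theorem AbsolutelyContinuousOnInterval.of_dist_le {f h : ℝ → ℝ} {a b K : ℝ}
    (hf : AbsolutelyContinuousOnInterval f a b)
    (hK : ∀ x y, dist (h x) (h y) ≤ K * dist (f x) (f y)) :
    AbsolutelyContinuousOnInterval h a b := by
  refine squeeze_zero (fun t ↦ Finset.sum_nonneg fun i _ ↦ dist_nonneg) (fun t ↦ ?_)
    (by simpa using Filter.Tendsto.const_mul K hf)
  rw [Finset.mul_sum]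
  exact Finset.sum_le_sum fun i _ ↦ hK _ _

/-- The derivative `g' / (2 √g)` of the root of a density `g`. -/
noncomputable def rootDeriv (g : ℝ → ℝ) (e : ℝ) : ℝ := deriv g e / (2 * √(g e))

theorem measurable_rootDeriv {g : ℝ → ℝ} (hg : Measurable g) : Measurable (rootDeriv g) :=
  (measurable_deriv g).div (hg.sqrt.const_mul 2)

/-- A zero of g is a minimum. Hence the convention x / 0 = 0 in g'/g and in `rootDeriv` only ever
meets 0 / 0. -/
theorem deriv_eq_zero_of_nonneg {g : ℝ → ℝ} (hg : ∀ e, 0 ≤ g e) {e : ℝ} (he : g e = 0) :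
    deriv g e = 0 :=
  IsLocalMin.deriv_eq_zero (Filter.Eventually.of_forall fun x ↦ he ▸ hg x)

theorem rootDeriv_sq {g : ℝ → ℝ} (hg : ∀ e, 0 ≤ g e) (e : ℝ) :
    rootDeriv g e ^ 2 = deriv g e ^ 2 / g e / 4 := by
  rw [rootDeriv, div_pow, mul_pow, Real.sq_sqrt (hg e)]
  ring

theorem rootDeriv_eq {g : ℝ → ℝ} (hg : ∀ e, 0 ≤ g e) (e : ℝ) :
    deriv g e / g e * √(g e) = 2 * rootDeriv g e := by
  rcases eq_or_ne (g e) 0 with h | h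
  · simp [rootDeriv, h]
  · have h1 : √(g e) ≠ 0 := (Real.sqrt_pos.2 (lt_of_le_of_ne (hg e) h.symm)).ne'
    rw [rootDeriv]
    field_simp
    rw [Real.sq_sqrt (hg e)]

namespace IsErrorDensity

variable {g : ℝ → ℝ}

theorem rootDeriv_neg (hg : IsErrorDensity g) (e : ℝ) : rootDeriv g (-e) = -rootDeriv g e := by
  have h : deriv g (-e) = -deriv g e := by
    have h1 : (fun x ↦ g (-x)) = g := funext hg.symm
    have h2 := deriv_comp_neg g e
    rw [h1] at h2
    linarith
  rw [rootDeriv, rootDeriv, h, hg.symm, neg_div]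

theorem memLp_rootDeriv (hg : IsErrorDensity g) : MemLp (rootDeriv g) 2 := by
  rw [memLp_two_iff_integrable_sq (measurable_rootDeriv hg.isDensity.measurable).aestronglyMeasurable]
  simp_rw [rootDeriv_sq hg.isDensity.nonneg]
  exact hg.finite_info.div_const 4

/-- The square root is not Lipschitz near 0, so absolute continuity does not pass directly from g to
√g. It does pass to √(g + δ) for δ > 0, whose derivative is dominated by |`rootDeriv g`|; this is in
L², hence locally integrable, and δ → 0 gives the claim. -/
theorem sqrt_sub_sqrt (hg : IsErrorDensity g) (a b : ℝ) : √(g b) - √(g a) = ∫ e in a..b, rootDeriv g e := by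
  have hg0 := hg.isDensity.nonneg
  have key : ∀ δ : ℝ, 0 < δ →
      ∫ e in a..b, deriv g e / (2 * √(g e + δ)) = √(g b + δ) - √(g a + δ) := by
    intro δ hδ
    have hac : AbsolutelyContinuousOnInterval (fun e ↦ √(g e + δ)) a b := by
      -- The sum of the two roots is at least √δ, whence the Lipschitz constant.
      refine (hg.absolutelyContinuous a b).of_dist_le (K := (√δ)⁻¹) fun x y ↦ ?_
      have hs : 0 < √δ := Real.sqrt_pos.2 hδ
      have hx : √δ ≤ √(g x + δ) := Real.sqrt_le_sqrt (by linarith [hg0 x])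
      have hy : 0 ≤ √(g y + δ) := Real.sqrt_nonneg _
      rw [inv_mul_eq_div, le_div_iff₀ hs, Real.dist_eq, Real.dist_eq]
      have : g x - g y = (√(g x + δ) - √(g y + δ)) * (√(g x + δ) + √(g y + δ)) := by
        have h1 := Real.sq_sqrt (show 0 ≤ g x + δ by linarith [hg0 x])
        have h2 := Real.sq_sqrt (show 0 ≤ g y + δ by linarith [hg0 y])
        nlinarith
      rw [this, abs_mul, abs_of_nonneg (a := √(g x + δ) + √(g y + δ)) (by linarith)]
      exact mul_le_mul_of_nonneg_left (by linarith) (abs_nonneg _)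
    rw [← hac.integral_deriv_eq_sub]
    refine intervalIntegral.integral_congr_ae ?_
    filter_upwards [(hg.absolutelyContinuous a b).ae_differentiableAt] with x hx hxm
    have hd := (hx (Set.uIoc_subset_uIcc hxm)).hasDerivAt
    exact ((hd.add_const δ).sqrt (by linarith [hg0 x])).deriv.symm
  have hlim : Tendsto (fun δ : ℝ ↦ √(g b + δ) - √(g a + δ)) (𝓝[>] 0) (𝓝 (√(g b) - √(g a))) := by
    have : Continuous fun δ : ℝ ↦ √(g b + δ) - √(g a + δ) := by fun_prop
    simpa using (this.tendsto 0).mono_left nhdsWithin_le_nhds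
  refine tendsto_nhds_unique hlim (Tendsto.congr' (f₁ := fun δ : ℝ ↦
    ∫ e in a..b, deriv g e / (2 * √(g e + δ))) ?_ ?_)
  · filter_upwards [self_mem_nhdsWithin] with δ hδ using key δ hδ
  · refine intervalIntegral.tendsto_integral_filter_of_dominated_convergence
      (fun e ↦ |rootDeriv g e|) ?_ ?_ ?_ ?_
    · refine Eventually.of_forall fun δ ↦ Measurable.aestronglyMeasurable ?_
      exact (measurable_deriv g).div (((hg.isDensity.measurable.add_const δ).sqrt).const_mul 2)
    · filter_upwards [self_mem_nhdsWithin] with δ hδ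
      refine Eventually.of_forall fun e _ ↦ ?_
      rcases eq_or_ne (g e) 0 with h | h
      · simp [deriv_eq_zero_of_nonneg hg0 h]
      · have hp : 0 < √(g e) := Real.sqrt_pos.2 (lt_of_le_of_ne (hg0 e) h.symm)
        rw [Real.norm_eq_abs, rootDeriv, abs_div, abs_div, abs_of_pos (a := 2 * √(g e)) (by positivity),
          abs_of_nonneg (a := 2 * √(g e + δ)) (by positivity)]
        have : √(g e) ≤ √(g e + δ) := Real.sqrt_le_sqrt (by linarith [Set.mem_Ioi.1 hδ])
        gcongr
    · have : LocallyIntegrable (rootDeriv g) := hg.memLp_rootDeriv.locallyIntegrable one_le_two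
      exact (this.integrableOn_isCompact isCompact_uIcc).intervalIntegrable.abs
    · refine Eventually.of_forall fun e _ ↦ ?_
      rcases eq_or_ne (g e) 0 with h | h
      · simp [rootDeriv, deriv_eq_zero_of_nonneg hg0 h]
      · have hp : 0 < √(g e) := Real.sqrt_pos.2 (lt_of_le_of_ne (hg0 e) h.symm)
        have hc : ContinuousAt (fun δ : ℝ ↦ deriv g e / (2 * √(g e + δ))) 0 := by
          refine ContinuousAt.div (by fun_prop) (by fun_prop) ?_
          simpa using hp.ne'
        simpa [rootDeriv] using hc.tendsto.mono_left nhdsWithin_le_nhds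

end IsErrorDensity

/-! ### Translations in `L²(ℝ)` -/

section Translation

theorem eLpNorm_two_sq {α : Type*} [MeasurableSpace α] (μ : Measure α) (f : α → ℝ) :
    eLpNorm f 2 μ ^ 2 = ∫⁻ a, ‖f a‖ₑ ^ 2 ∂μ := by
  have := eLpNorm_nnreal_pow_eq_lintegral (μ := μ) (f := f) (p := 2) two_ne_zero
  simpa using this

theorem MeasureTheory.MemLp.lintegral_sq_ne_top {α : Type*} [MeasurableSpace α] {μ : Measure α} {f : α → ℝ}
    (hf : MemLp f 2 μ) : ∫⁻ a, ‖f a‖ₑ ^ 2 ∂μ ≠ ∞ := by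
  rw [← eLpNorm_two_sq]
  exact ENNReal.pow_ne_top hf.2.ne

theorem memLp_two_of_lintegral_ne_top {α : Type*} [MeasurableSpace α] {μ : Measure α} {f : α → ℝ}
    (hf : AEStronglyMeasurable f μ) (h : ∫⁻ a, ‖f a‖ₑ ^ 2 ∂μ ≠ ∞) : MemLp f 2 μ := by
  refine ⟨hf, lt_top_iff_ne_top.2 fun h' ↦ h ?_⟩
  rw [← eLpNorm_two_sq, h']
  simp

theorem enorm_add_sq_le (a b : ℝ) : ‖a + b‖ₑ ^ 2 ≤ 2 * ‖a‖ₑ ^ 2 + 2 * ‖b‖ₑ ^ 2 := by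
  have h : ‖a + b‖₊ ^ 2 ≤ 2 * ‖a‖₊ ^ 2 + 2 * ‖b‖₊ ^ 2 := by
    rw [← NNReal.coe_le_coe]
    push_cast
    simp only [Real.norm_eq_abs, sq_abs]
    nlinarith [sq_nonneg (a - b)]
  simp only [enorm_eq_nnnorm]
  exact_mod_cast h

theorem lintegral_sq_le {α : Type*} [MeasurableSpace α] (μ : Measure α) [IsProbabilityMeasure μ]
    {h : α → ℝ≥0∞} (hh : AEMeasurable h μ) : (∫⁻ a, h a ∂μ) ^ 2 ≤ ∫⁻ a, h a ^ 2 ∂μ := by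
  have := ENNReal.lintegral_mul_le_Lp_mul_Lq μ Real.HolderConjugate.two_two hh
    (aemeasurable_const (b := (1 : ℝ≥0∞)))
  simp only [Pi.mul_apply, mul_one, lintegral_const, measure_univ,
    ENNReal.rpow_two, one_pow, ENNReal.one_rpow] at this
  calc _ ≤ ((∫⁻ a, h a ^ 2 ∂μ) ^ (1 / 2 : ℝ)) ^ 2 := by gcongr
    _ = _ := by rw [← ENNReal.rpow_natCast, ← ENNReal.rpow_mul]; norm_num

/-- The squared `L²` distance between `ψ` and its translate by `u`. -/
noncomputable def shiftModulus (ψ : ℝ → ℝ) (u : ℝ) : ℝ≥0∞ := ∫⁻ e, ‖ψ (e - u) - ψ e‖ₑ ^ 2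

variable {ψ : ℝ → ℝ}

theorem shiftModulus_le (hψ : Measurable ψ) (u : ℝ) :
    shiftModulus ψ u ≤ 4 * ∫⁻ e, ‖ψ e‖ₑ ^ 2 := by
  calc shiftModulus ψ u ≤ ∫⁻ e, (2 * ‖ψ (e - u)‖ₑ ^ 2 + 2 * ‖ψ e‖ₑ ^ 2) := by
        refine lintegral_mono fun e ↦ ?_
        simpa [sub_eq_add_neg] using enorm_add_sq_le (ψ (e - u)) (-ψ e)
    _ = 4 * ∫⁻ e, ‖ψ e‖ₑ ^ 2 := by
        rw [lintegral_add_left (by fun_prop), lintegral_const_mul _ (by fun_prop),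
          lintegral_const_mul _ (by fun_prop),
          lintegral_sub_right_eq_self (fun e ↦ ‖ψ e‖ₑ ^ 2) u, ← add_mul]
        norm_num

/-- Translations depend continuously on u and preserve Lebesgue measure, and composition with such a
family is continuous into L². -/
theorem tendsto_shiftModulus (hψ : MemLp ψ 2) : Tendsto (shiftModulus ψ) (𝓝 0) (𝓝 0) := by
  let c : C(ℝ, C(ℝ, ℝ)) := ContinuousMap.curry ⟨fun x : ℝ × ℝ ↦ x.2 - x.1, by fun_prop⟩
  have hc : ∀ u, MeasurePreserving (c u) volume volume := fun u ↦ measurePreserving_sub_right volume u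
  have h := Filter.Tendsto.compMeasurePreservingLp (f := fun _ : ℝ ↦ hψ.toLp ψ) (l := 𝓝 (0 : ℝ))
    tendsto_const_nhds (c.continuous.tendsto 0) hc (hc 0) (by simp)
  rw [tendsto_iff_edist_tendsto_0] at h
  have h2 := (ENNReal.continuous_pow 2).tendsto 0 |>.comp h
  simp only [ne_eq, OfNat.ofNat_ne_zero, not_false_eq_true, zero_pow] at h2
  refine h2.congr fun u ↦ ?_
  have hcoe : ∀ u, Lp.compMeasurePreserving (c u) (hc u) (hψ.toLp ψ)
      = ((hψ.comp_measurePreserving (hc u)).toLp _) := fun u ↦ Lp.toLp_compMeasurePreserving hψ (hc u)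
  simp only [Function.comp_apply]
  rw [hcoe, hcoe, Lp.edist_toLp_toLp, eLpNorm_two_sq]
  simp [shiftModulus, c]

/-- Squared `L²` remainder in the first-order expansion of a translate. -/
theorem lintegral_shift_remainder_le {f : ℝ → ℝ} (hm : Measurable ψ) (hψ : MemLp ψ 2)
    (hf : ∀ a b, f b - f a = ∫ e in a..b, ψ e) (u : ℝ) :
    ∫⁻ e, ‖f (e - u) - f e + u * ψ e‖ₑ ^ 2 ≤
      ‖u‖ₑ ^ 2 * ∫⁻ t in Set.Ioc (0 : ℝ) 1, shiftModulus ψ (t * u) := by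
  have : IsProbabilityMeasure (volume.restrict (Set.Ioc (0 : ℝ) 1)) := ⟨by simp⟩
  have hli : LocallyIntegrable ψ := hψ.locallyIntegrable one_le_two
  have hii : ∀ a b : ℝ, IntervalIntegrable ψ volume a b := fun a b ↦
    (hli.integrableOn_isCompact isCompact_uIcc).intervalIntegrable
  have hmeas : Measurable fun x : ℝ × ℝ ↦ ‖ψ (x.1 - x.2 * u) - ψ x.1‖ₑ ^ 2 := by fun_prop
  -- The remainder is −u times the average of ψ(e − tu) − ψ(e) over t in [0, 1]. Cauchy–Schwarz in t
  -- and Tonelli then turn its squared norm into an average of shift moduli.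
  have hrep : ∀ e, f (e - u) - f e + u * ψ e
      = -u * ∫ t in (0 : ℝ)..1, (ψ (e - t * u) - ψ e) := by
    intro e
    rcases eq_or_ne u 0 with rfl | hu
    · simp
    have h1 : ∫ t in (0 : ℝ)..1, ψ (-u * t + e) = (-u)⁻¹ • ∫ x in e..e - u, ψ x := by
      rw [intervalIntegral.integral_comp_mul_add _ (neg_ne_zero.2 hu)]
      simp [neg_add_eq_sub]
    have h2 : IntervalIntegrable (fun t ↦ ψ (-u * t + e)) volume 0 1 := by
      have := (hii (-u * 0 + e) (-u * 1 + e)).comp_add_right e |>.comp_mul_left (c := -u)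
      refine (this.congr fun t _ ↦ rfl).mono_set ?_
      simp [hu]
    have h3 : ∀ t, ψ (e - t * u) = ψ (-u * t + e) := fun t ↦ by congr 1; ring
    simp_rw [h3]
    rw [intervalIntegral.integral_sub h2 intervalIntegrable_const, h1, ← hf e (e - u)]
    simp only [intervalIntegral.integral_const, smul_eq_mul]
    field_simp
    ring
  calc ∫⁻ e, ‖f (e - u) - f e + u * ψ e‖ₑ ^ 2
      ≤ ∫⁻ e, ‖u‖ₑ ^ 2 * ∫⁻ t in Set.Ioc (0 : ℝ) 1, ‖ψ (e - t * u) - ψ e‖ₑ ^ 2 := by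
        refine lintegral_mono fun e ↦ ?_
        simp only [hrep, enorm_mul, enorm_neg, mul_pow]
        gcongr
        rw [intervalIntegral.integral_of_le zero_le_one]
        refine le_trans ?_ (lintegral_sq_le _ (by fun_prop))
        gcongr
        exact enorm_integral_le_lintegral_enorm _
    _ = ‖u‖ₑ ^ 2 * ∫⁻ t in Set.Ioc (0 : ℝ) 1, shiftModulus ψ (t * u) := by
        rw [lintegral_const_mul _ (hmeas.lintegral_prod_right'), lintegral_lintegral_swap
          hmeas.aemeasurable]
        rfl

/-- Shifting a function `f` with derivative `ψ ∈ L²` is `L²`-differentiable, and shifting `ψ` is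
`L²`-continuous, with a common bounded modulus `κ`. -/
theorem exists_shift_modulus {f : ℝ → ℝ} (hm : Measurable ψ) (hψ : MemLp ψ 2)
    (hf : ∀ a b, f b - f a = ∫ e in a..b, ψ e) :
    ∃ κ : ℝ → ℝ≥0∞, (∃ C ≠ ∞, ∀ u, κ u ≤ C) ∧ Tendsto κ (𝓝 0) (𝓝 0) ∧
      (∀ u, ∫⁻ e, ‖ψ (e - u) - ψ e‖ₑ ^ 2 ≤ κ u) ∧
      ∀ u, ∫⁻ e, ‖f (e - u) - f e + u * ψ e‖ₑ ^ 2 ≤ ‖u‖ₑ ^ 2 * κ u := by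
  have hC : 4 * ∫⁻ e, ‖ψ e‖ₑ ^ 2 ≠ ∞ := ENNReal.mul_ne_top (by simp) hψ.lintegral_sq_ne_top
  have hle := shiftModulus_le hm
  -- The first summand controls the shift of ψ, the second the remainder for f.
  refine ⟨fun u ↦ shiftModulus ψ u + ∫⁻ t in Set.Ioc (0 : ℝ) 1, shiftModulus ψ (t * u),
    ⟨_, ENNReal.add_ne_top.2 ⟨hC, hC⟩, fun u ↦ add_le_add (hle u) ?_⟩, ?_,
    fun u ↦ le_self_add, fun u ↦ (lintegral_shift_remainder_le hm hψ hf u).trans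
      (mul_le_mul_right le_add_self _)⟩
  · calc _ ≤ ∫⁻ t in Set.Ioc (0 : ℝ) 1, 4 * ∫⁻ e, ‖ψ e‖ₑ ^ 2 := lintegral_mono fun t ↦ hle _
      _ = _ := by simp
  · have h0 := tendsto_shiftModulus hψ
    rw [← add_zero (0 : ℝ≥0∞)]
    refine h0.add ?_
    rw [ENNReal.tendsto_nhds_zero] at h0 ⊢
    intro ε hε
    obtain ⟨δ, hδ, h⟩ := Metric.eventually_nhds_iff.1 (h0 ε hε)
    filter_upwards [Metric.ball_mem_nhds 0 hδ] with u hu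
    calc _ ≤ ∫⁻ t in Set.Ioc (0 : ℝ) 1, ε := by
          refine setLIntegral_mono measurable_const fun t ht ↦ h ?_
          simp only [Metric.mem_ball, dist_zero_right, norm_mul, Real.norm_eq_abs] at hu ⊢
          rw [abs_of_pos ht.1]
          nlinarith [abs_nonneg u, ht.2]
      _ = ε := by simp

end Translation

/-! ### `L²`-differentiability along perturbations of a location parameter -/

section Shift

variable {W ι E : Type*} [MeasurableSpace W] [NormedAddCommGroup E] {l : Filter ι}

/-- The family `F` is `o(r)` in `L²(μ)`. -/
def IsLittleOL2 (μ : Measure W) (F : ι → W → ℝ) (r : ι → E) (l : Filter ι) : Prop :=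
  ∀ ε : ℝ≥0∞, ε ≠ 0 → ∀ᶠ i in l, ∫⁻ w, ‖F i w‖ₑ ^ 2 ∂μ ≤ ε * ‖r i‖ₑ ^ 2

theorem IsLittleOL2.isLittleO {μ : Measure W} {F : ι → W → ℝ} {r : ι → E}
    (h : IsLittleOL2 μ F r l) : (fun i ↦ (eLpNorm (F i) 2 μ).toReal) =o[l] r := by
  refine isLittleO_iff.2 fun c hc ↦ ?_
  filter_upwards [h (ENNReal.ofReal c ^ 2) (by simpa using hc)] with i hi
  rw [← eLpNorm_two_sq, ← mul_pow] at hi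
  have h1 := (ENNReal.pow_right_strictMono two_ne_zero).le_iff_le.1 hi
  rw [Real.norm_of_nonneg ENNReal.toReal_nonneg]
  refine ENNReal.toReal_le_of_le_ofReal (by positivity) (h1.trans_eq ?_)
  rw [ENNReal.ofReal_mul hc.le, ofReal_norm]

/-- Membership in L² matters here: `toReal` sends ∞ to 0, so a family of infinite norm would
otherwise pass for a small one. -/
theorem isLittleOL2_of_isLittleO {μ : Measure W} {F : ι → W → ℝ} {r : ι → E}
    (hF : ∀ᶠ i in l, MemLp (F i) 2 μ)
    (h : (fun i ↦ (eLpNorm (F i) 2 μ).toReal) =o[l] r) : IsLittleOL2 μ F r l := by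
  intro ε hε
  obtain ⟨c, hc, hcε⟩ : ∃ c : ℝ, 0 < c ∧ ENNReal.ofReal c ^ 2 ≤ ε := by
    have : Tendsto (fun c : ℝ ↦ ENNReal.ofReal c ^ 2) (𝓝[>] 0) (𝓝 0) := by
      have h2 : Continuous fun c : ℝ ↦ ENNReal.ofReal c ^ 2 :=
        (ENNReal.continuous_pow 2).comp ENNReal.continuous_ofReal
      simpa using (h2.tendsto 0).mono_left nhdsWithin_le_nhds
    obtain ⟨c, h1, h2⟩ := ((this.eventually (ge_mem_nhds (pos_iff_ne_zero.2 hε))).and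
      self_mem_nhdsWithin).exists
    exact ⟨c, h2, h1⟩
  filter_upwards [hF, isLittleO_iff.1 h hc] with i hi hb
  rw [← eLpNorm_two_sq]
  rw [Real.norm_of_nonneg ENNReal.toReal_nonneg] at hb
  calc _ ≤ (ENNReal.ofReal (c * ‖r i‖)) ^ 2 := by
        gcongr
        exact (ENNReal.le_ofReal_iff_toReal_le hi.2.ne (by positivity)).2 hb
    _ = ENNReal.ofReal c ^ 2 * ‖r i‖ₑ ^ 2 := by
        rw [ENNReal.ofReal_mul hc.le, ofReal_norm, mul_pow]
    _ ≤ _ := by gcongr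

theorem IsLittleOL2.mono {μ : Measure W} {F F' : ι → W → ℝ} {r : ι → E} {K : ℝ≥0∞} (hK : K ≠ ∞)
    (h : IsLittleOL2 μ F r l)
    (hF : ∀ᶠ i in l, ∫⁻ w, ‖F' i w‖ₑ ^ 2 ∂μ ≤ K * ∫⁻ w, ‖F i w‖ₑ ^ 2 ∂μ) :
    IsLittleOL2 μ F' r l := by
  intro ε hε
  filter_upwards [h (ε / K) (by simp [ENNReal.div_eq_zero_iff, hε, hK]), hF] with i hi hi'
  calc _ ≤ K * (ε / K * ‖r i‖ₑ ^ 2) := hi'.trans (by gcongr)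
    _ = (K * (ε / K)) * ‖r i‖ₑ ^ 2 := (mul_assoc _ _ _).symm
    _ ≤ _ := by gcongr; exact ENNReal.mul_div_le

theorem lintegral_enorm_add_sq_le {μ : Measure W} {F G : W → ℝ} (hF : AEMeasurable F μ) :
    ∫⁻ w, ‖F w + G w‖ₑ ^ 2 ∂μ ≤ 2 * ∫⁻ w, ‖F w‖ₑ ^ 2 ∂μ + 2 * ∫⁻ w, ‖G w‖ₑ ^ 2 ∂μ := by
  calc _ ≤ ∫⁻ w, (2 * ‖F w‖ₑ ^ 2 + 2 * ‖G w‖ₑ ^ 2) ∂μ :=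
        lintegral_mono fun w ↦ enorm_add_sq_le _ _
    _ = _ := by
        rw [lintegral_add_left' (by fun_prop), lintegral_const_mul' _ _ (by simp),
          lintegral_const_mul' _ _ (by simp)]

theorem IsLittleOL2.add {μ : Measure W} {F G : ι → W → ℝ} {r : ι → E}
    (hm : ∀ᶠ i in l, AEMeasurable (F i) μ)
    (hF : IsLittleOL2 μ F r l) (hG : IsLittleOL2 μ G r l) :
    IsLittleOL2 μ (fun i w ↦ F i w + G i w) r l := by
  intro ε hε
  have hε' : ε / 2 / 2 ≠ 0 := by simp [ENNReal.div_eq_zero_iff, hε]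
  filter_upwards [hm, hF _ hε', hG _ hε'] with i hi h1 h2
  calc _ ≤ 2 * (ε / 2 / 2 * ‖r i‖ₑ ^ 2) + 2 * (ε / 2 / 2 * ‖r i‖ₑ ^ 2) :=
        (lintegral_enorm_add_sq_le hi).trans (by gcongr)
    _ = ((2 * (ε / 2 / 2)) + (2 * (ε / 2 / 2))) * ‖r i‖ₑ ^ 2 := by ring
    _ = _ := by rw [ENNReal.mul_div_cancel (by simp) (by simp), ENNReal.add_halves]

theorem IsLittleOL2.tendsto {μ : Measure W} {F : ι → W → ℝ} {r : ι → E}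
    (h : IsLittleOL2 μ F r l) (hr : Tendsto r l (𝓝 0)) :
    Tendsto (fun i ↦ ∫⁻ w, ‖F i w‖ₑ ^ 2 ∂μ) l (𝓝 0) := by
  have h1 : Tendsto (fun i ↦ 1 * ‖r i‖ₑ ^ 2) l (𝓝 0) := by
    have := ((ENNReal.continuous_pow 2).comp continuous_enorm).tendsto (0 : E) |>.comp hr
    simpa [Function.comp_def] using this
  exact tendsto_of_tendsto_of_tendsto_of_le_of_le' tendsto_const_nhds h1
    (Eventually.of_forall fun _ ↦ zero_le) (h 1 one_ne_zero)

/-- Bounded moduli of continuity average out along a family that tends to `0` in `L²`. -/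
theorem tendsto_lintegral_mul_modulus {μ : Measure W} {h : W → ℝ≥0∞} (hm : Measurable h)
    (hh : ∫⁻ w, h w ∂μ ≠ ∞) {κ : ℝ → ℝ≥0∞} {C : ℝ≥0∞} (hC : C ≠ ∞) (hκC : ∀ u, κ u ≤ C)
    (hκ : Tendsto κ (𝓝 0) (𝓝 0)) {v : ι → W → ℝ} (hvm : ∀ᶠ i in l, Measurable (v i))
    (hv : Tendsto (fun i ↦ ∫⁻ w, ‖v i w‖ₑ ^ 2 ∂μ) l (𝓝 0)) :
    Tendsto (fun i ↦ ∫⁻ w, h w * κ (v i w) ∂μ) l (𝓝 0) := by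
  rw [ENNReal.tendsto_nhds_zero]
  intro ε hε
  set I := ∫⁻ w, h w ∂μ with hI
  have hε' : 0 < ε / 2 / I := by
    simp [pos_iff_ne_zero, ENNReal.div_eq_zero_iff, hε.ne', hh]
  obtain ⟨δ, hδ, hδκ⟩ := Metric.eventually_nhds_iff.1 ((ENNReal.tendsto_nhds_zero.1 hκ) _ hε')
  -- Where |v| < δ the modulus κ(v) is small. On the complement κ ≤ C, and by Chebyshev the measure
  -- of this set tends to 0, so the integral of h over it does too.
  let s : ι → Set W := fun i ↦ {w | ENNReal.ofReal δ ^ 2 ≤ ‖v i w‖ₑ ^ 2}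
  have hδ0 : ENNReal.ofReal δ ^ 2 ≠ 0 := by simpa using hδ
  have hs : Tendsto (μ ∘ s) l (𝓝 0) := by
    have h1 : Tendsto (fun i ↦ (∫⁻ w, ‖v i w‖ₑ ^ 2 ∂μ) / ENNReal.ofReal δ ^ 2) l (𝓝 0) := by
      simpa using ENNReal.Tendsto.div_const hv (Or.inr hδ0)
    refine tendsto_of_tendsto_of_tendsto_of_le_of_le' tendsto_const_nhds h1
      (Eventually.of_forall fun _ ↦ zero_le) ?_
    filter_upwards [hvm] with i hi
    exact meas_ge_le_lintegral_div (by fun_prop) hδ0 (by finiteness)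
  have hset := tendsto_setLIntegral_zero hh hs
  have hset' : Tendsto (fun i ↦ C * ∫⁻ w in s i, h w ∂μ) l (𝓝 0) := by
    simpa using ENNReal.Tendsto.const_mul hset (Or.inr hC)
  filter_upwards [hvm, ENNReal.tendsto_nhds_zero.1 hset' (ε / 2) (by simpa using hε.ne')]
    with i hi hi2
  have hsm : MeasurableSet (s i) := measurableSet_le measurable_const (by fun_prop)
  calc ∫⁻ w, h w * κ (v i w) ∂μ
      ≤ ∫⁻ w, (ε / 2 / I * h w + C * (s i).indicator h w) ∂μ := by
        refine lintegral_mono fun w ↦ ?_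
        by_cases hw : w ∈ s i
        · simp only [hw, Set.indicator_of_mem]
          exact le_add_left (by rw [mul_comm C]; exact mul_le_mul_right (hκC _) _)
        · have : dist (v i w) 0 < δ := by
            simp only [s, Set.mem_ofPred_eq, not_le] at hw
            have := (ENNReal.pow_right_strictMono two_ne_zero).lt_iff_lt.1 hw
            rw [← ofReal_norm] at this
            rw [dist_zero_right]
            exact (ENNReal.ofReal_lt_ofReal_iff hδ).1 this
          refine le_add_right ?_
          rw [mul_comm]
          exact mul_le_mul_left (hδκ this) _
    _ = ε / 2 / I * I + C * ∫⁻ w in s i, h w ∂μ := by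
        rw [lintegral_add_left (by fun_prop), lintegral_const_mul _ hm,
          lintegral_const_mul _ (hm.indicator hsm), lintegral_indicator hsm]
    _ ≤ ε / 2 + ε / 2 := by
        gcongr
        rw [mul_comm]
        exact ENNReal.mul_div_le
    _ = ε := ENNReal.add_halves ε

variable {ρ : Measure W} {q : W → ℝ} {c : W → ℝ}

/-- Integration of `q(w) K(w, y - c(w))` over `w` and `y`. -/
theorem lintegral_prod_shift (hq : Measurable q) (hq0 : ∀ w, 0 ≤ q w) (hc : Measurable c)
    {K : W → ℝ → ℝ} (hK : Measurable (Function.uncurry K)) :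
    ∫⁻ z, ‖√(q z.1) * K z.1 (z.2 - c z.1)‖ₑ ^ 2 ∂(ρ.prod volume) =
      ∫⁻ w, (∫⁻ e, ‖K w e‖ₑ ^ 2) ∂(ρ.withDensity fun w ↦ ENNReal.ofReal (q w)) := by
  have hKs : Measurable fun z : W × ℝ ↦ K z.1 (z.2 - c z.1) :=
    hK.comp (measurable_fst.prodMk (measurable_snd.sub (hc.comp measurable_fst)))
  have hI : Measurable fun w ↦ ∫⁻ e, ‖K w e‖ₑ ^ 2 := (hK.enorm.pow_const 2).lintegral_prod_right'
  have hJ : Measurable fun z : W × ℝ ↦ ‖√(q z.1) * K z.1 (z.2 - c z.1)‖ₑ ^ 2 :=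
    ((hq.comp measurable_fst).sqrt.mul hKs).enorm.pow_const 2
  rw [lintegral_prod _ hJ.aemeasurable,
    lintegral_withDensity_eq_lintegral_mul _ hq.ennreal_ofReal hI]
  refine lintegral_congr fun w ↦ ?_
  have hKw : Measurable (K w) := hK.comp measurable_prodMk_left
  simp only [enorm_mul, mul_pow, Pi.mul_apply]
  rw [lintegral_const_mul _ (by fun_prop), lintegral_sub_right_eq_self (fun e ↦ ‖K w e‖ₑ ^ 2)]
  congr 1
  rw [Real.enorm_of_nonneg (Real.sqrt_nonneg _), ← ENNReal.ofReal_pow (Real.sqrt_nonneg _),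
    Real.sq_sqrt (hq0 w)]

variable {f ψ : ℝ → ℝ} {κ : ℝ → ℝ≥0∞} {C : ℝ≥0∞}

/-- For fixed w, linearising f costs |v|² κ(v) and replacing v by L costs |v − L|² ‖ψ‖². Since |v|²
≤ 2|L|² + 2|v − L|², the first cost has a part bounded by |r|² |h|² κ(v), in which κ(v) averages out
against the integrable h², and a part bounded by C |v − L|², which is already o(|r|²). -/
theorem isLittleOL2_shift (hq : Measurable q) (hq0 : ∀ w, 0 ≤ q w) (hc : Measurable c)
    (hf : Measurable f) (hψm : Measurable ψ) (hψ : MemLp ψ 2) (hC : C ≠ ∞) (hκC : ∀ u, κ u ≤ C)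
    (hκ : Tendsto κ (𝓝 0) (𝓝 0))
    (hfκ : ∀ u, ∫⁻ e, ‖f (e - u) - f e + u * ψ e‖ₑ ^ 2 ≤ ‖u‖ₑ ^ 2 * κ u)
    {r : ι → E} (hr : Tendsto r l (𝓝 0)) {v L : ι → W → ℝ} (hv : ∀ᶠ i in l, Measurable (v i))
    (hL : ∀ i, Measurable (L i)) {h : W → ℝ} (hhm : Measurable h)
    (hh : MemLp h 2 (ρ.withDensity fun w ↦ ENNReal.ofReal (q w)))
    (hLh : ∀ i w, ‖L i w‖ₑ ≤ ‖r i‖ₑ * ‖h w‖ₑ)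
    (hvL : IsLittleOL2 (ρ.withDensity fun w ↦ ENNReal.ofReal (q w))
      (fun i w ↦ v i w - L i w) r l) :
    IsLittleOL2 (ρ.prod volume) (fun i z ↦ √(q z.1) * (f (z.2 - c z.1 - v i z.1)
      - f (z.2 - c z.1) + L i z.1 * ψ (z.2 - c z.1))) r l := by
  set μ := ρ.withDensity fun w ↦ ENNReal.ofReal (q w)
  have hh2 := hh.lintegral_sq_ne_top
  set H := ∫⁻ w, ‖h w‖ₑ ^ 2 ∂μ
  have hΨ := hψ.lintegral_sq_ne_top
  set Ψ := ∫⁻ e, ‖ψ e‖ₑ ^ 2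
  have hL2 : ∀ i w, ‖L i w‖ₑ ^ 2 ≤ ‖r i‖ₑ ^ 2 * ‖h w‖ₑ ^ 2 := fun i w ↦ by
    rw [← mul_pow]; gcongr; exact hLh i w
  have hLt : Tendsto (fun i ↦ ∫⁻ w, ‖L i w‖ₑ ^ 2 ∂μ) l (𝓝 0) := by
    have h1 : Tendsto (fun i ↦ ‖r i‖ₑ ^ 2 * H) l (𝓝 0) := by
      have := ((ENNReal.continuous_pow 2).comp continuous_enorm).tendsto (0 : E) |>.comp hr
      simpa [Function.comp_def] using ENNReal.Tendsto.mul_const this (Or.inr hh2)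
    refine tendsto_of_tendsto_of_tendsto_of_le_of_le tendsto_const_nhds h1 (fun _ ↦ zero_le)
      fun i ↦ ?_
    calc _ ≤ ∫⁻ w, ‖r i‖ₑ ^ 2 * ‖h w‖ₑ ^ 2 ∂μ := lintegral_mono (hL2 i)
      _ = _ := lintegral_const_mul' _ _ (by finiteness)
  have hvt : Tendsto (fun i ↦ ∫⁻ w, ‖v i w‖ₑ ^ 2 ∂μ) l (𝓝 0) := by
    have h1 : Tendsto (fun i ↦ 2 * ∫⁻ w, ‖L i w‖ₑ ^ 2 ∂μ + 2 * ∫⁻ w, ‖v i w - L i w‖ₑ ^ 2 ∂μ) l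
        (𝓝 0) := by
      simpa using (ENNReal.Tendsto.const_mul hLt (Or.inr (by simp))).add
        (ENNReal.Tendsto.const_mul (hvL.tendsto hr) (Or.inr (by simp)))
    refine tendsto_of_tendsto_of_tendsto_of_le_of_le tendsto_const_nhds h1 (fun _ ↦ zero_le)
      fun i ↦ ?_
    simpa using lintegral_enorm_add_sq_le (μ := μ) (F := L i) (G := fun w ↦ v i w - L i w)
      (hL i).aemeasurable
  have hmod := tendsto_lintegral_mul_modulus (h := fun w ↦ ‖h w‖ₑ ^ 2) (by fun_prop) hh2 hC hκC hκ
    hv hvt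
  intro ε hε
  have hε2 : ε / 2 ≠ 0 := by simp [ENNReal.div_eq_zero_iff, hε]
  -- The total coefficient of |v − L|²: 4C from linearising f, 2Ψ from replacing v by L.
  set K := 4 * C + 2 * Ψ
  have hK : K ≠ ∞ := by finiteness
  have hmod' : Tendsto (fun i ↦ 4 * ∫⁻ w, ‖h w‖ₑ ^ 2 * κ (v i w) ∂μ) l (𝓝 0) := by
    simpa using ENNReal.Tendsto.const_mul hmod (Or.inr (by simp))
  filter_upwards [hv, ENNReal.tendsto_nhds_zero.1 hmod' (ε / 2) (pos_iff_ne_zero.2 hε2),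
    hvL (ε / 2 / K) (by simp [ENNReal.div_eq_zero_iff, hε, hK])] with i hi h1 h2
  have hLi := hL i
  rw [lintegral_prod_shift hq hq0 hc (K := fun w e ↦ f (e - v i w) - f e + L i w * ψ e)
    (by unfold Function.uncurry; fun_prop)]
  calc ∫⁻ w, (∫⁻ e, ‖f (e - v i w) - f e + L i w * ψ e‖ₑ ^ 2) ∂μ
      ≤ ∫⁻ w, (4 * ‖r i‖ₑ ^ 2 * (‖h w‖ₑ ^ 2 * κ (v i w)) + K * ‖v i w - L i w‖ₑ ^ 2) ∂μ := by
        refine lintegral_mono fun w ↦ ?_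
        calc ∫⁻ e, ‖f (e - v i w) - f e + L i w * ψ e‖ₑ ^ 2
            = ∫⁻ e, ‖(f (e - v i w) - f e + v i w * ψ e) + (-(v i w - L i w)) * ψ e‖ₑ ^ 2 := by
              congr 1 with e; congr 2; ring
          _ ≤ 2 * (‖v i w‖ₑ ^ 2 * κ (v i w)) + 2 * (‖v i w - L i w‖ₑ ^ 2 * Ψ) := by
              refine (lintegral_enorm_add_sq_le (by fun_prop)).trans ?_
              gcongr
              · exact hfκ _
              · simp only [enorm_mul, enorm_neg, mul_pow]
                rw [lintegral_const_mul _ (by fun_prop)]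
          _ ≤ 2 * ((2 * (‖r i‖ₑ ^ 2 * ‖h w‖ₑ ^ 2) + 2 * ‖v i w - L i w‖ₑ ^ 2) * κ (v i w)) +
                2 * (‖v i w - L i w‖ₑ ^ 2 * Ψ) := by
              gcongr
              have := enorm_add_sq_le (L i w) (v i w - L i w)
              rw [add_sub_cancel] at this
              exact this.trans (by gcongr; exact hL2 i w)
          _ = 4 * ‖r i‖ₑ ^ 2 * (‖h w‖ₑ ^ 2 * κ (v i w)) +
                (4 * κ (v i w) + 2 * Ψ) * ‖v i w - L i w‖ₑ ^ 2 := by ring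
          _ ≤ _ := by
              simp only [K]
              gcongr
              exact hκC _
    _ = ‖r i‖ₑ ^ 2 * (4 * ∫⁻ w, ‖h w‖ₑ ^ 2 * κ (v i w) ∂μ) +
          K * ∫⁻ w, ‖v i w - L i w‖ₑ ^ 2 ∂μ := by
        rw [lintegral_add_right _ (by fun_prop), lintegral_const_mul' _ _ (by finiteness),
          lintegral_const_mul' _ _ hK]
        ring
    _ ≤ ‖r i‖ₑ ^ 2 * (ε / 2) + K * (ε / 2 / K * ‖r i‖ₑ ^ 2) := by gcongr
    _ = ‖r i‖ₑ ^ 2 * (ε / 2) + K * (ε / 2 / K) * ‖r i‖ₑ ^ 2 := by rw [mul_assoc K]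
    _ ≤ ‖r i‖ₑ ^ 2 * (ε / 2) + ε / 2 * ‖r i‖ₑ ^ 2 := by gcongr; exact ENNReal.mul_div_le
    _ = (ε / 2 + ε / 2) * ‖r i‖ₑ ^ 2 := by ring
    _ = _ := by rw [ENNReal.add_halves]

/-- The integral over y is at most |b|² κ(v); boundedness of κ makes convergence of v to 0 in L²
sufficient. This is used to show that odd test functions change sign under the reflections in the
limit. -/
theorem tendsto_lintegral_shift (hq : Measurable q) (hq0 : ∀ w, 0 ≤ q w) (hc : Measurable c)
    (hψm : Measurable ψ) (hC : C ≠ ∞) (hκC : ∀ u, κ u ≤ C) (hκ : Tendsto κ (𝓝 0) (𝓝 0))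
    (hψκ : ∀ u, ∫⁻ e, ‖ψ (e - u) - ψ e‖ₑ ^ 2 ≤ κ u)
    {v : ι → W → ℝ} (hv : ∀ᶠ i in l, Measurable (v i)) {b : W → ℝ} (hbm : Measurable b)
    (hb : MemLp b 2 (ρ.withDensity fun w ↦ ENNReal.ofReal (q w)))
    (hvt : Tendsto (fun i ↦ ∫⁻ w, ‖v i w‖ₑ ^ 2 ∂(ρ.withDensity fun w ↦ ENNReal.ofReal (q w)))
      l (𝓝 0)) :
    Tendsto (fun i ↦ ∫⁻ z, ‖√(q z.1) * (b z.1 * (ψ (z.2 - c z.1 - v i z.1) - ψ (z.2 - c z.1)))‖ₑ ^ 2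
      ∂(ρ.prod volume)) l (𝓝 0) := by
  have hmod := tendsto_lintegral_mul_modulus (h := fun w ↦ ‖b w‖ₑ ^ 2) (by fun_prop)
    hb.lintegral_sq_ne_top hC hκC hκ hv hvt
  refine tendsto_of_tendsto_of_tendsto_of_le_of_le' tendsto_const_nhds hmod
    (Eventually.of_forall fun _ ↦ zero_le) ?_
  filter_upwards [hv] with i hi
  rw [lintegral_prod_shift hq hq0 hc (K := fun w e ↦ b w * (ψ (e - v i w) - ψ e))
    (by unfold Function.uncurry; fun_prop)]
  refine lintegral_mono fun w ↦ ?_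
  simp only [enorm_mul, mul_pow]
  rw [lintegral_const_mul _ (by fun_prop)]
  gcongr
  exact hψκ _

end Shift

/-! ### The law of covariates and residual -/

section Law

theorem IsDensity.isProbabilityMeasure {α : Type*} [MeasurableSpace α] {ν : Measure α} {f : α → ℝ}
    (hf : IsDensity ν f) : IsProbabilityMeasure (ν.withDensity fun a ↦ ENNReal.ofReal (f a)) :=
  ⟨by simpa using hf.lintegral_eq_one⟩

variable {p d : ℕ} {ν₁ : Measure (Fin p → ℝ)} {P : Params p d}

theorem IsAdditive.measurable {q : (Fin p → ℝ) × (Fin d → ℝ) → ℝ} {m : (Fin d → ℝ) → ℝ}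
    (h : IsAdditive ν₁ q m) : Measurable m := by
  obtain ⟨-, c, hc, hs, -⟩ := h
  rw [funext hs]
  exact Finset.measurable_sum _ fun j _ ↦ (hc j).comp (measurable_pi_apply j)

/-- The regression function `xᵀβ + m(z)`. -/
def Params.mean (P : Params p d) (w : (Fin p → ℝ) × (Fin d → ℝ)) : ℝ := w.1 ⬝ᵥ P.beta + P.m w.2

theorem Params.resid_eq (w : ((Fin p → ℝ) × (Fin d → ℝ)) × ℝ) :
    P.resid w = w.2 - P.mean w.1 := sub_sub _ _ _

theorem measurable_dotProduct_const (β : Fin p → ℝ) : Measurable fun x : Fin p → ℝ ↦ x ⬝ᵥ β := by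
  simp only [dotProduct]
  fun_prop

theorem Params.measurable_mean (hm : Measurable P.m) : Measurable P.mean :=
  ((measurable_dotProduct_const P.beta).comp measurable_fst).add (hm.comp measurable_snd)

theorem Params.measurable_resid (hm : Measurable P.m) : Measurable P.resid := by
  simp_rw [funext fun w ↦ P.resid_eq w]
  exact measurable_snd.sub ((Params.measurable_mean hm).comp measurable_fst)

theorem measurePreserving_sub_fst {W : Type*} [MeasurableSpace W] (ρ : Measure W) [SigmaFinite ρ]
    {c : W → ℝ} (hc : Measurable c) :
    MeasurePreserving (fun z : W × ℝ ↦ (z.1, z.2 - c z.1)) (ρ.prod volume) (ρ.prod volume) :=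
  (MeasurePreserving.id ρ).skew_product (g := fun w y ↦ y - c w)
    (measurable_snd.sub (hc.comp measurable_fst))
    (Eventually.of_forall fun w ↦ (measurePreserving_sub_right volume (c w)).map_eq)

/-- With c twice a regression function, this is the reflection of the response about that function.
-/
theorem measurePreserving_sub_snd {W : Type*} [MeasurableSpace W] (ρ : Measure W) [SigmaFinite ρ]
    {c : W → ℝ} (hc : Measurable c) :
    MeasurePreserving (fun z : W × ℝ ↦ (z.1, c z.1 - z.2)) (ρ.prod volume) (ρ.prod volume) :=
  (MeasurePreserving.id ρ).skew_product (g := fun w y ↦ c w - y)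
    ((hc.comp measurable_fst).sub measurable_snd)
    (Eventually.of_forall fun w ↦ (Measure.measurePreserving_sub_left volume (c w)).map_eq)

theorem MeasureTheory.MeasurePreserving.withDensity_comp {α β : Type*} [MeasurableSpace α]
    [MeasurableSpace β] {μ : Measure α} {ν : Measure β} {T : α → β} (hT : MeasurePreserving T μ ν)
    {F : β → ℝ≥0∞} (hF : Measurable F) :
    MeasurePreserving T (μ.withDensity fun a ↦ F (T a)) (ν.withDensity F) := by
  refine ⟨hT.measurable, Measure.ext fun s hs ↦ ?_⟩
  rw [Measure.map_apply hT.measurable hs, withDensity_apply _ hs,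
    withDensity_apply _ (hT.measurable hs), hT.setLIntegral_comp_preimage hs hF]

/-- The covariates and the residual are independent under `P`. -/
theorem Params.measurePreserving_resid [SigmaFinite ν₁] (hq : Measurable P.q) (hq0 : ∀ w, 0 ≤ P.q w)
    (hg : Measurable P.g) (hm : Measurable P.m) :
    MeasurePreserving (fun w ↦ (w.1, P.resid w)) (P.law ν₁)
      ((covLaw ν₁ P.q).prod (volume.withDensity fun e ↦ ENNReal.ofReal (P.g e))) := by
  have : SigmaFinite (covRef d ν₁) := by unfold covRef; infer_instance
  have h := (measurePreserving_sub_fst (covRef d ν₁) (Params.measurable_mean hm)).withDensity_comp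
    (F := fun z ↦ ENNReal.ofReal (P.q z.1) * ENNReal.ofReal (P.g z.2)) (by fun_prop)
  have hlaw : P.law ν₁ = ((covRef d ν₁).prod volume).withDensity fun z ↦
      ENNReal.ofReal (P.q z.1) * ENNReal.ofReal (P.g (z.2 - P.mean z.1)) := by
    rw [Params.law, obsRef]
    congr 1 with w
    rw [Params.density, ENNReal.ofReal_mul (hq0 _), Params.resid_eq]
  rw [covLaw, prod_withDensity (by fun_prop) (by fun_prop), hlaw,
    show (fun w ↦ (w.1, P.resid w)) = fun z : ((Fin p → ℝ) × (Fin d → ℝ)) × ℝ ↦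
      (z.1, z.2 - P.mean z.1) from funext fun z ↦ by rw [Params.resid_eq]]
  exact h

theorem Params.measurable_density (hq : Measurable P.q) (hg : Measurable P.g)
    (hm : Measurable P.m) : Measurable P.density :=
  (hq.comp measurable_fst).mul (hg.comp (Params.measurable_resid hm))

/-- The score `-b(x, z) (g'/g)(y - xᵀβ - m(z))` for a perturbation of the mean in direction `b`. -/
noncomputable def shiftScore (P : Params p d) (b : (Fin p → ℝ) × (Fin d → ℝ) → ℝ)
    (w : ((Fin p → ℝ) × (Fin d → ℝ)) × ℝ) : ℝ :=
  -b w.1 * (deriv P.g (P.resid w) / P.g (P.resid w))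

theorem Params.isProbabilityMeasure_law [SigmaFinite ν₁] (hq : IsDensity (covRef d ν₁) P.q) (hg : IsErrorDensity P.g)
    (hm : Measurable P.m) : IsProbabilityMeasure (P.law ν₁) := by
  have h := Params.measurePreserving_resid (ν₁ := ν₁) hq.measurable hq.nonneg
    hg.isDensity.measurable hm
  have h1 : IsProbabilityMeasure (covLaw ν₁ P.q) := hq.isProbabilityMeasure
  have h2 := hg.isDensity.isProbabilityMeasure
  exact ⟨by rw [← Set.preimage_univ, h.measure_preimage MeasurableSet.univ.nullMeasurableSet,
    measure_univ]⟩

theorem Params.measurePreserving_fst [SigmaFinite ν₁] (hq : IsDensity (covRef d ν₁) P.q) (hg : IsErrorDensity P.g)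
    (hm : Measurable P.m) :
    MeasurePreserving Prod.fst (P.law ν₁) (covLaw ν₁ P.q) := by
  have h1 : IsProbabilityMeasure (covLaw ν₁ P.q) := hq.isProbabilityMeasure
  have h2 := hg.isDensity.isProbabilityMeasure
  have h := MeasureTheory.measurePreserving_fst (μ := covLaw ν₁ P.q)
    (ν := volume.withDensity fun e ↦ ENNReal.ofReal (P.g e))
  have h' := Params.measurePreserving_resid (ν₁ := ν₁) hq.measurable hq.nonneg
    hg.isDensity.measurable hm
  have h'' := h.comp h'
  exact h''

theorem integral_ratio_sq {g : ℝ → ℝ} (hg : IsErrorDensity g) :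
    ∫ e, (deriv g e / g e) * (deriv g e / g e) ∂(volume.withDensity fun e ↦ ENNReal.ofReal (g e))
      = fisherInfo g := by
  rw [integral_withDensity_eq_integral_toReal_smul (hg.isDensity.measurable.ennreal_ofReal) (by simp),
    fisherInfo]
  congr 1 with e
  rw [ENNReal.toReal_ofReal (hg.isDensity.nonneg e), smul_eq_mul]
  rcases eq_or_ne (g e) 0 with h | h
  · simp [h]
  · field_simp

theorem memLp_ratio {g : ℝ → ℝ} (hg : IsErrorDensity g) :
    MemLp (fun e ↦ deriv g e / g e) 2 (volume.withDensity fun e ↦ ENNReal.ofReal (g e)) := by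
  have hm := hg.isDensity.measurable
  have hr : Measurable fun e ↦ deriv g e / g e := (measurable_deriv g).div hm
  rw [memLp_two_iff_integrable_sq hr.aestronglyMeasurable,
    integrable_withDensity_iff_integrable_smul' hm.ennreal_ofReal (by simp)]
  refine hg.finite_info.congr (Eventually.of_forall fun e ↦ ?_)
  simp only [ENNReal.toReal_ofReal (hg.isDensity.nonneg e), smul_eq_mul]
  rcases eq_or_ne (g e) 0 with h | h
  · simp [h]
  · field_simp

/-- Covariates and residual are independent under P, so the integral factors; the residual
contributes the Fisher information. -/
theorem integral_shiftScore_mul [SigmaFinite ν₁] (hq : IsDensity (covRef d ν₁) P.q) (hg : IsErrorDensity P.g)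
    (hm : Measurable P.m) {b b' : (Fin p → ℝ) × (Fin d → ℝ) → ℝ} (hb : Measurable b)
    (hb' : Measurable b') :
    ∫ w, shiftScore P b w * shiftScore P b' w ∂(P.law ν₁) =
      fisherInfo P.g * ∫ w, b w * b' w ∂(covLaw ν₁ P.q) := by
  have hT := Params.measurePreserving_resid (ν₁ := ν₁) hq.measurable hq.nonneg
    hg.isDensity.measurable hm
  have h1 : IsProbabilityMeasure (covLaw ν₁ P.q) := hq.isProbabilityMeasure
  have h2 := hg.isDensity.isProbabilityMeasure
  have hr : Measurable fun e ↦ deriv P.g e / P.g e := (measurable_deriv _).div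
    hg.isDensity.measurable
  rw [← integral_ratio_sq hg, mul_comm, ← integral_prod_mul, ← hT.map_eq, integral_map
    hT.aemeasurable]
  · congr 1 with w
    simp only [shiftScore]
    ring
  · exact (((hb.mul hb').comp measurable_fst).mul
      ((hr.mul hr).comp measurable_snd)).aestronglyMeasurable

theorem memLp_shiftScore [SigmaFinite ν₁] (hq : IsDensity (covRef d ν₁) P.q) (hg : IsErrorDensity P.g)
    (hm : Measurable P.m) {b : (Fin p → ℝ) × (Fin d → ℝ) → ℝ} (hbm : Measurable b)
    (hb : MemLp b 2 (covLaw ν₁ P.q)) : MemLp (shiftScore P b) 2 (P.law ν₁) := by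
  have hT := Params.measurePreserving_resid (ν₁ := ν₁) hq.measurable hq.nonneg
    hg.isDensity.measurable hm
  have h1 : IsProbabilityMeasure (covLaw ν₁ P.q) := hq.isProbabilityMeasure
  have h2 := hg.isDensity.isProbabilityMeasure
  have hr : Measurable fun e ↦ deriv P.g e / P.g e := (measurable_deriv _).div
    hg.isDensity.measurable
  have hs : Measurable (shiftScore P b) := (hbm.comp measurable_fst).neg.mul
    (hr.comp (Params.measurable_resid hm))
  rw [memLp_two_iff_integrable_sq hs.aestronglyMeasurable]
  have h3 := hb.integrable_sq.mul_prod (memLp_ratio hg).integrable_sq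
  refine ((hT.integrable_comp h3.aestronglyMeasurable).2 h3).congr
    (Eventually.of_forall fun w ↦ ?_)
  simp only [Function.comp_apply, shiftScore]
  ring

/-! ### Passing to root densities -/

theorem lintegral_density [SigmaFinite ν₁] (hq : IsDensity (covRef d ν₁) P.q) (hg : IsErrorDensity P.g)
    (hm : Measurable P.m) : ∫⁻ w, ENNReal.ofReal (P.density w) ∂(obsRef d ν₁) = 1 := by
  have := Params.isProbabilityMeasure_law hq hg hm
  have h := measure_univ (μ := P.law ν₁)
  rwa [Params.law, withDensity_apply _ MeasurableSet.univ, Measure.restrict_univ] at h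

theorem Params.density_nonneg (hq : IsDensity (covRef d ν₁) P.q) (hg : IsErrorDensity P.g)
    (w) : 0 ≤ P.density w := mul_nonneg (hq.nonneg _) (hg.isDensity.nonneg _)

theorem memLp_sqrt_density [SigmaFinite ν₁] (hq : IsDensity (covRef d ν₁) P.q) (hg : IsErrorDensity P.g)
    (hm : Measurable P.m) : MemLp (fun w ↦ √(P.density w)) 2 (obsRef d ν₁) := by
  refine memLp_two_of_lintegral_ne_top (Params.measurable_density hq.measurable
    hg.isDensity.measurable hm).sqrt.aestronglyMeasurable ?_
  have h : ∀ w, ‖√(P.density w)‖ₑ ^ 2 = ENNReal.ofReal (P.density w) := fun w ↦ by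
    rw [Real.enorm_of_nonneg (Real.sqrt_nonneg _), ← ENNReal.ofReal_pow (Real.sqrt_nonneg _),
      Real.sq_sqrt (Params.density_nonneg hq hg w)]
  simp [h, lintegral_density hq hg hm]

theorem integral_mul_sqrt_density (hq : IsDensity (covRef d ν₁) P.q) (hg : IsErrorDensity P.g)
    (hm : Measurable P.m) (s t : ((Fin p → ℝ) × (Fin d → ℝ)) × ℝ → ℝ) :
    ∫ w, (s w * √(P.density w)) * (t w * √(P.density w)) ∂(obsRef d ν₁) =
      ∫ w, s w * t w ∂(P.law ν₁) := by
  have hpm := Params.measurable_density hq.measurable hg.isDensity.measurable hm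
  rw [Params.law, integral_withDensity_eq_integral_toReal_smul hpm.ennreal_ofReal (by simp)]
  congr 1 with w
  have h0 := Params.density_nonneg hq hg w
  rw [ENNReal.toReal_ofReal h0, smul_eq_mul]
  linear_combination s w * t w * Real.mul_self_sqrt h0

theorem MeasureTheory.MemLp.mul_sqrt_density (hq : IsDensity (covRef d ν₁) P.q)
    (hg : IsErrorDensity P.g) (hm : Measurable P.m) {s : ((Fin p → ℝ) × (Fin d → ℝ)) × ℝ → ℝ}
    (hsm : Measurable s) (hs : MemLp s 2 (P.law ν₁)) :
    MemLp (fun w ↦ s w * √(P.density w)) 2 (obsRef d ν₁) := by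
  have hpm := Params.measurable_density hq.measurable hg.isDensity.measurable hm
  refine (memLp_two_iff_integrable_sq (hsm.mul hpm.sqrt).aestronglyMeasurable).2 ?_
  have h := hs.integrable_sq
  rw [Params.law, integrable_withDensity_iff_integrable_smul' hpm.ennreal_ofReal (by simp)] at h
  refine h.congr (Eventually.of_forall fun w ↦ ?_)
  have h0 := Params.density_nonneg hq hg w
  simp only [ENNReal.toReal_ofReal h0, smul_eq_mul, Pi.mul_apply, mul_pow, Real.sq_sqrt h0,
    mul_comm]

/-- Brings the score into the form √q · b · ψ(y − c) that the shift estimates handle. -/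
theorem shiftScore_mul_sqrt_density (hq : IsDensity (covRef d ν₁) P.q) (hg : IsErrorDensity P.g)
    (b : (Fin p → ℝ) × (Fin d → ℝ) → ℝ) (w : ((Fin p → ℝ) × (Fin d → ℝ)) × ℝ) :
    shiftScore P b w * √(P.density w) =
      -2 * (√(P.q w.1) * (b w.1 * rootDeriv P.g (P.resid w))) := by
  rw [Params.density, Real.sqrt_mul (hq.nonneg _), shiftScore]
  linear_combination -b w.1 * √(P.q w.1) * rootDeriv_eq hg.isDensity.nonneg (P.resid w)

/-- A null set of the law can fail to be null for the reference measure only where the density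
vanishes, and there both products are 0. -/
theorem ae_mul_sqrt_density (hq : IsDensity (covRef d ν₁) P.q) (hg : IsErrorDensity P.g)
    (hm : Measurable P.m) {s t : ((Fin p → ℝ) × (Fin d → ℝ)) × ℝ → ℝ} (h : s =ᵐ[P.law ν₁] t) :
    ∀ᵐ w ∂(obsRef d ν₁), s w * √(P.density w) = t w * √(P.density w) := by
  have hpm := Params.measurable_density hq.measurable hg.isDensity.measurable hm
  have h' := (ae_withDensity_iff hpm.ennreal_ofReal).1 h
  filter_upwards [h'] with w hw
  rcases eq_or_lt_of_le (Params.density_nonneg hq hg w) with h0 | h0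
  · simp [← h0]
  · rw [hw (by simpa using h0)]

end Law

/-! ### Limits of inner products in L². -/

section L2Limits

variable {W ι : Type*} [MeasurableSpace W] {l : Filter ι} {μ : Measure W}

/-- Joint continuity of the inner product of L². The families are in L² only eventually, so the
remaining members are replaced by 0. -/
theorem tendsto_integral_mul {F G : ι → W → ℝ} {F₀ G₀ : W → ℝ}
    (hF : ∀ᶠ i in l, MemLp (F i) 2 μ) (hG : ∀ᶠ i in l, MemLp (G i) 2 μ)
    (hF₀ : MemLp F₀ 2 μ) (hG₀ : MemLp G₀ 2 μ)
    (hFt : Tendsto (fun i ↦ ∫⁻ w, ‖F i w - F₀ w‖ₑ ^ 2 ∂μ) l (𝓝 0))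
    (hGt : Tendsto (fun i ↦ ∫⁻ w, ‖G i w - G₀ w‖ₑ ^ 2 ∂μ) l (𝓝 0)) :
    Tendsto (fun i ↦ ∫ w, F i w * G i w ∂μ) l (𝓝 (∫ w, F₀ w * G₀ w ∂μ)) := by
  classical
  have hsq : ∀ {u : ι → ℝ≥0∞}, Tendsto (fun i ↦ u i ^ 2) l (𝓝 0) → Tendsto u l (𝓝 0) := by
    intro u hu
    have h1 := (ENNReal.continuous_rpow_const (y := (1 / 2 : ℝ))).tendsto 0 |>.comp hu
    simp only [Function.comp_def] at h1
    rw [ENNReal.zero_rpow_of_pos (by norm_num)] at h1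
    refine h1.congr fun i ↦ ?_
    rw [← ENNReal.rpow_natCast, ← ENNReal.rpow_mul]
    norm_num
  have key : ∀ {F : ι → W → ℝ} {F₀ : W → ℝ} (hF : ∀ᶠ i in l, MemLp (F i) 2 μ)
      (hF₀ : MemLp F₀ 2 μ)
      (_ : Tendsto (fun i ↦ ∫⁻ w, ‖F i w - F₀ w‖ₑ ^ 2 ∂μ) l (𝓝 0)),
      Tendsto (fun i ↦ if h : MemLp (F i) 2 μ then h.toLp (F i) else 0) l (𝓝 (hF₀.toLp F₀)) := by
    intro F F₀ hF hF₀ h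
    rw [tendsto_iff_edist_tendsto_0]
    simp_rw [← eLpNorm_two_sq] at h
    refine (hsq h).congr' ?_
    filter_upwards [hF] with i hi
    rw [dif_pos hi, Lp.edist_toLp_toLp]
    rfl
  have h := (key hF hF₀ hFt).inner (𝕜 := ℝ) (key hG hG₀ hGt)
  have hin : ∀ {f g : W → ℝ} (hf : MemLp f 2 μ) (hg : MemLp g 2 μ),
      inner ℝ (hf.toLp f) (hg.toLp g) = ∫ w, f w * g w ∂μ := by
    intro f g hf hg
    rw [L2.inner_def]
    refine integral_congr_ae ?_
    filter_upwards [hf.coeFn_toLp, hg.coeFn_toLp] with w h1 h2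
    rw [h1, h2]
    simp [mul_comm]
  rw [hin] at h
  refine h.congr' ?_
  filter_upwards [hF, hG] with i h1 h2
  rw [dif_pos h1, dif_pos h2, hin]

theorem IsLittleOL2.comp_tendsto {κ E : Type*} [NormedAddCommGroup E] {l' : Filter κ}
    {F : ι → W → ℝ} {r : ι → E} (h : IsLittleOL2 μ F r l) {u : κ → ι} (hu : Tendsto u l' l) :
    IsLittleOL2 μ (fun k ↦ F (u k)) (fun k ↦ r (u k)) l' :=
  fun ε hε ↦ hu.eventually (h ε hε)

theorem IsLittleOL2.congr {E E' : Type*} [NormedAddCommGroup E] [NormedAddCommGroup E']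
    {F F' : ι → W → ℝ} {r : ι → E} {r' : ι → E'} (h : IsLittleOL2 μ F r l)
    (hF : ∀ i, F i =ᵐ[μ] F' i) (hr : ∀ i, ‖r i‖ₑ = ‖r' i‖ₑ) : IsLittleOL2 μ F' r' l := by
  intro ε hε
  filter_upwards [h ε hε] with i hi
  have h1 : ∫⁻ w, ‖F i w‖ₑ ^ 2 ∂μ = ∫⁻ w, ‖F' i w‖ₑ ^ 2 ∂μ := lintegral_congr_ae (by
    filter_upwards [hF i] with w hw
    rw [hw])
  rw [← hr, ← h1]
  exact hi

theorem IsLittleOL2.tendsto_div {F : ℝ → W → ℝ}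
    (h : IsLittleOL2 μ F (fun t : ℝ ↦ t) (𝓝[≠] 0)) :
    Tendsto (fun t ↦ ∫⁻ w, ‖F t w / t‖ₑ ^ 2 ∂μ) (𝓝[≠] 0) (𝓝 0) := by
  rw [ENNReal.tendsto_nhds_zero]
  intro ε hε
  filter_upwards [h ε hε.ne', self_mem_nhdsWithin] with t ht ht0
  have ht0' : ‖t‖ₑ ≠ 0 := by simpa using ht0
  simp only [div_eq_inv_mul, enorm_mul, mul_pow]
  rw [lintegral_const_mul' _ _ (by finiteness)]
  calc _ ≤ ‖t⁻¹‖ₑ ^ 2 * (ε * ‖t‖ₑ ^ 2) := by gcongr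
    _ = ε * (‖t⁻¹‖ₑ * ‖t‖ₑ) ^ 2 := by ring
    _ ≤ ε := by rw [← enorm_mul, inv_mul_cancel₀ (by simpa using ht0)]; simp

end L2Limits

/-! ### Linear structure of the additive functions. -/

section Additive

variable {p d : ℕ} {ν₁ : Measure (Fin p → ℝ)} {q : (Fin p → ℝ) × (Fin d → ℝ) → ℝ}

theorem IsAdditive.add {m m' : (Fin d → ℝ) → ℝ} (h : IsAdditive ν₁ q m) (h' : IsAdditive ν₁ q m') :
    IsAdditive ν₁ q (fun z ↦ m z + m' z) := by
  obtain ⟨hm, c, hc, hs, hi⟩ := h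
  obtain ⟨hm', c', hc', hs', hi'⟩ := h'
  refine ⟨hm.add hm', fun j t ↦ c j t + c' j t, fun j ↦ (hc j).add (hc' j),
    fun z ↦ by simp [hs, hs', Finset.sum_add_distrib], fun j ↦ ⟨(hi j).1.add (hi' j).1, ?_⟩⟩
  rw [integral_add (hi j).1 (hi' j).1, (hi j).2, (hi' j).2, add_zero]

theorem IsAdditive.const_mul {m : (Fin d → ℝ) → ℝ} (h : IsAdditive ν₁ q m) (a : ℝ) :
    IsAdditive ν₁ q (fun z ↦ a * m z) := by
  obtain ⟨hm, c, hc, hs, hi⟩ := h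
  refine ⟨hm.const_mul a, fun j t ↦ a * c j t, fun j ↦ (hc j).const_mul a,
    fun z ↦ by simp [hs, Finset.mul_sum], fun j ↦ ⟨(hi j).1.const_mul a, ?_⟩⟩
  rw [integral_const_mul, (hi j).2, mul_zero]

theorem isAdditive_zero : IsAdditive ν₁ q (fun _ : Fin d → ℝ ↦ 0) :=
  ⟨MemLp.zero', fun _ _ ↦ 0, fun _ ↦ measurable_const, by simp, fun _ ↦ by simp⟩

theorem IsAdditive.sum {ι : Type*} (t : Finset ι) {m : ι → (Fin d → ℝ) → ℝ}
    (h : ∀ i ∈ t, IsAdditive ν₁ q (m i)) : IsAdditive ν₁ q (fun z ↦ ∑ i ∈ t, m i z) := by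
  classical
  induction t using Finset.induction_on with
  | empty => simpa using isAdditive_zero
  | insert i t hi ih =>
    simp_rw [Finset.sum_insert hi]
    exact (h i (Finset.mem_insert_self i t)).add
      (ih fun j hj ↦ h j (Finset.mem_insert_of_mem hj))

theorem IsAdditive.memLp_covLaw {m : (Fin d → ℝ) → ℝ} (h : IsAdditive ν₁ q m) :
    MemLp (fun w : (Fin p → ℝ) × (Fin d → ℝ) ↦ m w.2) 2 (covLaw ν₁ q) :=
  h.1.comp_measurePreserving ⟨measurable_snd, rfl⟩

end Additive

/-! ### Submodels that perturb the mean linearly -/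

section Submodel

variable {p d k : ℕ} {ν₁ : Measure (Fin p → ℝ)}
  {𝒬 : Set ((Fin p → ℝ) × (Fin d → ℝ) → ℝ)} {P₀ : Params p d}

/-- The derivative `xᵀB + δ(z)` of the mean `xᵀβ + m(z)` in the `i`-th coordinate. -/
def meanDeriv (B : Matrix (Fin p) (Fin k) ℝ) (δ : Fin k → (Fin d → ℝ) → ℝ) (i : Fin k)
    (w : (Fin p → ℝ) × (Fin d → ℝ)) : ℝ :=
  ∑ j, w.1 j * B j i + δ i w.2

theorem measurable_meanDeriv {B : Matrix (Fin p) (Fin k) ℝ} {δ : Fin k → (Fin d → ℝ) → ℝ}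
    {i : Fin k} (hδ : Measurable (δ i)) : Measurable (meanDeriv B δ i) := by
  unfold meanDeriv
  fun_prop

theorem memLp_meanDeriv {q : (Fin p → ℝ) × (Fin d → ℝ) → ℝ} {B : Matrix (Fin p) (Fin k) ℝ}
    {δ : Fin k → (Fin d → ℝ) → ℝ} {i : Fin k}
    (hX : ∀ j, MemLp (fun w : (Fin p → ℝ) × (Fin d → ℝ) => w.1 j) 2 (covLaw ν₁ q))
    (hδ : IsAdditive ν₁ q (δ i)) : MemLp (meanDeriv B δ i) 2 (covLaw ν₁ q) :=
  (memLp_finsetSum _ fun j _ ↦ (hX j).mul_const (B j i)).add hδ.memLp_covLaw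

theorem dotProduct_add_mulVec (x β : Fin p → ℝ) (B : Matrix (Fin p) (Fin k) ℝ) (h : Fin k → ℝ) :
    x ⬝ᵥ (β + B.mulVec h) = x ⬝ᵥ β + ∑ i, h i * ∑ j, x j * B j i := by
  rw [dotProduct_add]
  congr 1
  simp only [dotProduct, Matrix.mulVec, Finset.mul_sum]
  rw [Finset.sum_comm]
  exact Finset.sum_congr rfl fun i _ ↦ Finset.sum_congr rfl fun j _ ↦ by ring

/-- The densities of errors and covariates stay fixed and the mean is exactly affine in θ, so
`isLittleOL2_shift` applies with v = L. All submodels constructed later are of this kind. -/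
theorem isRegularSubmodel_of_linear [SigmaFinite ν₁] (hP₀ : P₀ ∈ model ν₁ 𝒬)
    (hq : IsDensity (covRef d ν₁) P₀.q)
    (hX : ∀ j, MemLp (fun w : (Fin p → ℝ) × (Fin d → ℝ) => w.1 j) 2 (covLaw ν₁ P₀.q))
    {θ₀ : Fin k → ℝ} {B : Matrix (Fin p) (Fin k) ℝ} {δ : Fin k → (Fin d → ℝ) → ℝ}
    (hδ : ∀ i, IsAdditive ν₁ P₀.q (δ i)) {P : (Fin k → ℝ) → Params p d}
    (hP : ∀ θ, P θ = { P₀ with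
      beta := P₀.beta + B.mulVec (θ - θ₀)
      m := fun z ↦ P₀.m z + ∑ i, (θ i - θ₀ i) * δ i z })
    {s : Fin k → Lp ℝ 2 (P₀.law ν₁)}
    (hs : ∀ i, s i =ᵐ[P₀.law ν₁] shiftScore P₀ (meanDeriv B δ i)) :
    IsRegularSubmodel ν₁ 𝒬 P₀ θ₀ P B s := by
  obtain ⟨hP𝒬, hg, hm⟩ := hP₀
  have hadd : ∀ θ, IsAdditive ν₁ P₀.q (P θ).m := fun θ ↦ by
    rw [hP]
    exact hm.add (IsAdditive.sum _ fun i _ ↦ (hδ i).const_mul _)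
  refine ⟨?_, ?_, Eventually.of_forall hadd, ?_, ⟨δ, hδ, ?_⟩, ?_⟩
  · rw [hP]
    simp
  · refine Eventually.of_forall fun θ ↦ ⟨?_, ?_, ?_⟩
    · simpa [hP] using hP𝒬
    · simpa [hP] using hg
    · have : (P θ).q = P₀.q := by rw [hP]
      rw [this]
      exact hadd θ
  · have h1 : (fun θ ↦ (P θ).beta) = fun θ ↦ P₀.beta + (Matrix.toLin' B).toContinuousLinearMap
        (θ - θ₀) := funext fun θ ↦ by rw [hP]; simp
    rw [h1]
    exact (((Matrix.toLin' B).toContinuousLinearMap.hasFDerivAt.comp θ₀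
      ((hasFDerivAt_id θ₀).sub_const θ₀))).const_add _
  · have h1 : ∀ θ, (fun z ↦ (P θ).m z - P₀.m z - ∑ i, (θ i - θ₀ i) * δ i z) = 0 := fun θ ↦ by
      funext z
      rw [hP]
      simp
    simp only [h1, eLpNorm_zero, ENNReal.toReal_zero]
    exact isLittleO_zero _ _
  · obtain ⟨κ, ⟨C, hC, hκC⟩, hκ, -, hfκ⟩ := exists_shift_modulus
      (measurable_rootDeriv hg.isDensity.measurable) hg.memLp_rootDeriv hg.sqrt_sub_sqrt
    have ha : ∀ i, Measurable (meanDeriv B δ i) := fun i ↦ measurable_meanDeriv (hδ i).measurable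
    have h := isLittleOL2_shift (ρ := covRef d ν₁) (l := 𝓝 θ₀) (r := fun θ ↦ θ - θ₀)
      (c := P₀.mean) (f := fun e ↦ √(P₀.g e))
      (v := fun θ w ↦ ∑ i, (θ i - θ₀ i) * meanDeriv B δ i w)
      (L := fun θ w ↦ ∑ i, (θ i - θ₀ i) * meanDeriv B δ i w)
      (h := fun w ↦ ∑ i, ‖meanDeriv B δ i w‖)
      hq.measurable hq.nonneg (Params.measurable_mean hm.measurable) hg.isDensity.measurable.sqrt
      (measurable_rootDeriv hg.isDensity.measurable) hg.memLp_rootDeriv hC hκC hκ hfκ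
      (by
        have : Continuous fun θ : Fin k → ℝ ↦ θ - θ₀ := by fun_prop
        simpa using this.tendsto θ₀)
      (Eventually.of_forall fun θ ↦ by fun_prop) (fun θ ↦ by fun_prop) (by fun_prop)
      (memLp_finsetSum _ fun i _ ↦ (memLp_meanDeriv hX (hδ i)).norm)
      (fun θ w ↦ by
        rw [← ofReal_norm, ← ofReal_norm, ← ofReal_norm, ← ENNReal.ofReal_mul (norm_nonneg _)]
        refine ENNReal.ofReal_le_ofReal ((norm_sum_le _ _).trans ?_)
        rw [Real.norm_of_nonneg (Finset.sum_nonneg fun i _ ↦ norm_nonneg _), Finset.mul_sum]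
        refine Finset.sum_le_sum fun i _ ↦ ?_
        rw [norm_mul]
        gcongr
        exact norm_le_pi_norm (θ - θ₀) i)
      (fun ε hε ↦ Eventually.of_forall fun θ ↦ by simp)
    rw [← obsRef] at h
    refine IsLittleOL2.isLittleO (h.congr (fun θ ↦ ?_) fun _ ↦ rfl)
    have hsd : ∀ᵐ w ∂(obsRef d ν₁), ∀ i, s i w * √(P₀.density w)
        = shiftScore P₀ (meanDeriv B δ i) w * √(P₀.density w) :=
      ae_all_iff.2 fun i ↦ ae_mul_sqrt_density hq hg hm.measurable (hs i)
    filter_upwards [hsd] with w hw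
    have hres : (P θ).resid w = w.2 - P₀.mean w.1 - ∑ i, (θ i - θ₀ i) * meanDeriv B δ i w.1 := by
      rw [hP, Params.resid_eq, Params.mean, Params.mean]
      simp only [dotProduct_add_mulVec, meanDeriv, mul_add, Finset.sum_add_distrib, Pi.sub_apply]
      ring
    have hd : √((P θ).density w) = √(P₀.q w.1) * √(P₀.g ((P θ).resid w)) := by
      rw [Params.density, Real.sqrt_mul (by rw [hP]; exact hq.nonneg _), hP]
    have hd0 : √(P₀.density w) = √(P₀.q w.1) * √(P₀.g (P₀.resid w)) := by
      rw [Params.density, Real.sqrt_mul (hq.nonneg _)]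
    simp only [hw, shiftScore_mul_sqrt_density hq hg]
    rw [hd, hd0, hres, Params.resid_eq]
    have hsum : ∑ i, (θ i - θ₀ i) * (-2 * (√(P₀.q w.1) * (meanDeriv B δ i w.1 *
        rootDeriv P₀.g (w.2 - P₀.mean w.1)))) = -2 * √(P₀.q w.1) *
        ((∑ i, (θ i - θ₀ i) * meanDeriv B δ i w.1) * rootDeriv P₀.g (w.2 - P₀.mean w.1)) := by
      rw [Finset.sum_mul, Finset.mul_sum]
      exact Finset.sum_congr rfl fun i _ ↦ by ring
    rw [hsum]
    ring

end Submodel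

/-! ### Scores of regular submodels

The reflection of the response about the regression function preserves the symmetric error
densities; comparing it along a submodel identifies the odd part of the score. -/

section Reflection

theorem integral_comp_of_measurePreserving {W : Type*} [MeasurableSpace W] {μ : Measure W}
    {R : W → W} (hR : MeasurePreserving R μ μ) {F : W → ℝ} (hF : Measurable F) :
    ∫ w, F (R w) ∂μ = ∫ w, F w ∂μ := by
  conv_rhs => rw [← hR.map_eq]
  exact (integral_map hR.aemeasurable hF.aestronglyMeasurable).symm

/-- If root densities `φ t` are invariant under measure-preserving involutions `R t`, then a
score `S` of the family and the derivative `D` of `t ↦ φ₀ ∘ R t` have the same inner product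
with functions `G` which are odd in the limit. -/
theorem integral_score_eq_of_reflection {W : Type*} [MeasurableSpace W] {μ : Measure W}
    {R : ℝ → W → W} {φ : ℝ → W → ℝ} {φ₀ S D G : W → ℝ}
    (hR : ∀ᶠ t in 𝓝[≠] 0, MeasurePreserving (R t) μ μ)
    (hRR : ∀ t w, R t (R t w) = w)
    (hφm : ∀ᶠ t in 𝓝[≠] 0, Measurable (φ t)) (hφ : ∀ᶠ t in 𝓝[≠] 0, MemLp (φ t) 2 μ)
    (hφR : ∀ᶠ t in 𝓝[≠] 0, ∀ w, φ t (R t w) = φ t w)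
    (hφ₀m : Measurable φ₀) (hφ₀ : MemLp φ₀ 2 μ) (hGm : Measurable G) (hG : MemLp G 2 μ)
    (hS : MemLp S 2 μ) (hD : MemLp D 2 μ)
    (hφS : IsLittleOL2 μ (fun t w ↦ φ t w - φ₀ w - 1 / 2 * (t * S w)) (fun t : ℝ ↦ t) (𝓝[≠] 0))
    (hφD : IsLittleOL2 μ (fun t w ↦ φ₀ (R t w) - φ₀ w - t * D w) (fun t : ℝ ↦ t) (𝓝[≠] 0))
    (hGR : Tendsto (fun t ↦ ∫⁻ w, ‖G w - G (R t w) - 2 * G w‖ₑ ^ 2 ∂μ) (𝓝[≠] 0) (𝓝 0)) :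
    ∫ w, S w * G w ∂μ = ∫ w, D w * G w ∂μ := by
  have hGRL : ∀ᶠ t in 𝓝[≠] (0 : ℝ), MemLp (fun w ↦ G (R t w)) 2 μ :=
    hR.mono fun t ht ↦ hG.comp_measurePreserving ht
  have hφRL : ∀ᶠ t in 𝓝[≠] (0 : ℝ), MemLp (fun w ↦ φ₀ (R t w)) 2 μ :=
    hR.mono fun t ht ↦ hφ₀.comp_measurePreserving ht
  have hne : ∀ᶠ t in 𝓝[≠] (0 : ℝ), t ≠ 0 := self_mem_nhdsWithin
  -- The limit is the inner product of S / 2 with 2G: the two factors cancel.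
  have h1 := tendsto_integral_mul (F := fun t w ↦ (φ t w - φ₀ w) / t)
    (G := fun t w ↦ G w - G (R t w)) (F₀ := fun w ↦ 1 / 2 * S w) (G₀ := fun w ↦ 2 * G w)
    (l := 𝓝[≠] (0 : ℝ)) (μ := μ)
    (by
      filter_upwards [hφ] with t ht
      simp only [div_eq_inv_mul]
      exact (ht.sub hφ₀).const_mul t⁻¹)
    (by filter_upwards [hGRL] with t ht using hG.sub ht)
    (hS.const_mul _) (hG.const_mul _)
    (by
      refine hφS.tendsto_div.congr' ?_
      filter_upwards [hne] with t ht
      congr 1 with w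
      congr 2
      field_simp) hGR
  have h2 := tendsto_integral_mul (F := fun t w ↦ (φ₀ (R t w) - φ₀ w) / t)
    (G := fun _ w ↦ G w) (F₀ := D) (G₀ := G) (l := 𝓝[≠] (0 : ℝ)) (μ := μ)
    (by
      filter_upwards [hφRL] with t ht
      simp only [div_eq_inv_mul]
      exact (ht.sub hφ₀).const_mul t⁻¹)
    (Eventually.of_forall fun _ ↦ hG) hD hG
    (by
      refine hφD.tendsto_div.congr' ?_
      filter_upwards [hne] with t ht
      congr 1 with w
      congr 2
      field_simp)
    (by simp)
  -- The two quotients agree before the limit. Invariance of φ_t gives ⟨φ_t, G − G∘R_t⟩ = 0, and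
  -- since R_t is a measure-preserving involution, ⟨φ₀, G∘R_t⟩ = ⟨φ₀∘R_t, G⟩. Thus φ_t enters only
  -- through its score.
  have h3 : ∀ᶠ t in 𝓝[≠] (0 : ℝ), ∫ w, (φ t w - φ₀ w) / t * (G w - G (R t w)) ∂μ =
      ∫ w, (φ₀ (R t w) - φ₀ w) / t * G w ∂μ := by
    filter_upwards [hR, hφm, hφ, hφR, hGRL, hφRL] with t hRt hmt hLt hRφ hGt hφt
    have e1 : ∫ w, φ t w * G (R t w) ∂μ = ∫ w, φ t w * G w ∂μ := by
      have := integral_comp_of_measurePreserving hRt (F := fun w ↦ φ t w * G w) (hmt.mul hGm)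
      simpa only [hRφ] using this
    have e2 : ∫ w, φ₀ w * G (R t w) ∂μ = ∫ w, φ₀ (R t w) * G w ∂μ := by
      have := integral_comp_of_measurePreserving hRt (F := fun w ↦ φ₀ w * G (R t w))
        (hφ₀m.mul (hGm.comp hRt.measurable))
      simpa only [hRR] using this.symm
    have i1 : Integrable (fun w ↦ φ t w * G w) μ := hLt.integrable_mul hG
    have i2 : Integrable (fun w ↦ φ t w * G (R t w)) μ := hLt.integrable_mul hGt
    have i3 : Integrable (fun w ↦ φ₀ w * G w) μ := hφ₀.integrable_mul hG
    have i4 : Integrable (fun w ↦ φ₀ w * G (R t w)) μ := hφ₀.integrable_mul hGt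
    have i5 : Integrable (fun w ↦ φ₀ (R t w) * G w) μ := hφt.integrable_mul hG
    have i6 : Integrable (fun w ↦ φ t w * G w - φ t w * G (R t w)) μ := i1.sub i2
    have i7 : Integrable (fun w ↦ φ₀ w * G w - φ₀ w * G (R t w)) μ := i3.sub i4
    have r1 : ∀ w, (φ t w - φ₀ w) / t * (G w - G (R t w)) = t⁻¹ * ((φ t w * G w -
        φ t w * G (R t w)) - (φ₀ w * G w - φ₀ w * G (R t w))) := fun w ↦ by ring
    have r2 : ∀ w, (φ₀ (R t w) - φ₀ w) / t * G w = t⁻¹ * (φ₀ (R t w) * G w - φ₀ w * G w) :=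
      fun w ↦ by ring
    simp_rw [r1, r2]
    rw [integral_const_mul, integral_const_mul, integral_sub i6 i7,
      integral_sub i1 i2, integral_sub i3 i4, integral_sub i5 i3, e1, e2]
    ring
  have h4 := tendsto_nhds_unique (h1.congr' h3) h2
  rw [← h4]
  congr 1 with w
  ring

end Reflection

/-! ### Mean derivatives and scores of arbitrary regular submodels. -/

section Necessity

variable {p d k : ℕ} {ν₁ : Measure (Fin p → ℝ)}
  {𝒬 : Set ((Fin p → ℝ) × (Fin d → ℝ) → ℝ)} {P₀ : Params p d}

/-- The bound |xᵀb| ≤ (∑_j |x_j|) ‖b‖, with the sum square integrable, reduces the claim to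
differentiability of β in ℝ^p. -/
theorem isLittleOL2_beta
    (hX : ∀ j, MemLp (fun w : (Fin p → ℝ) × (Fin d → ℝ) => w.1 j) 2 (covLaw ν₁ P₀.q))
    {θ₀ : Fin k → ℝ} {β : (Fin k → ℝ) → Fin p → ℝ} {B : Matrix (Fin p) (Fin k) ℝ}
    (hβ : HasFDerivAt β (Matrix.toLin' B).toContinuousLinearMap θ₀) :
    IsLittleOL2 (covLaw ν₁ P₀.q) (fun θ w ↦ w.1 ⬝ᵥ (β θ - β θ₀ - B.mulVec (θ - θ₀)))
      (fun θ ↦ θ - θ₀) (𝓝 θ₀) := by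
  have hN : MemLp (fun w : (Fin p → ℝ) × (Fin d → ℝ) ↦ ∑ j, ‖w.1 j‖) 2 (covLaw ν₁ P₀.q) :=
    memLp_finsetSum _ fun j _ ↦ (hX j).norm
  have hNm : Measurable fun w : (Fin p → ℝ) × (Fin d → ℝ) ↦ ∑ j, ‖w.1 j‖ := by fun_prop
  have hN2 := hN.lintegral_sq_ne_top
  have hbound : ∀ b : Fin p → ℝ, ∫⁻ w, ‖w.1 ⬝ᵥ b‖ₑ ^ 2 ∂(covLaw ν₁ P₀.q) ≤
      (∫⁻ w, ‖∑ j, ‖w.1 j‖‖ₑ ^ 2 ∂(covLaw ν₁ P₀.q)) * ‖b‖ₑ ^ 2 := by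
    intro b
    rw [← lintegral_mul_const _ (by fun_prop)]
    refine lintegral_mono fun w ↦ ?_
    rw [← mul_pow]
    gcongr
    rw [← ofReal_norm, ← ofReal_norm, ← ofReal_norm, ← ENNReal.ofReal_mul (norm_nonneg _)]
    refine ENNReal.ofReal_le_ofReal ((norm_sum_le _ _).trans ?_)
    rw [Real.norm_of_nonneg (Finset.sum_nonneg fun i _ ↦ norm_nonneg _), Finset.sum_mul]
    refine Finset.sum_le_sum fun i _ ↦ ?_
    rw [norm_mul]
    gcongr
    exact norm_le_pi_norm b i
  have hlo : (fun θ ↦ ‖β θ - β θ₀ - B.mulVec (θ - θ₀)‖) =o[𝓝 θ₀] fun θ ↦ θ - θ₀ := by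
    simpa using hβ.isLittleO.norm_left
  set N := ∫⁻ w, ‖∑ j, ‖w.1 j‖‖ₑ ^ 2 ∂(covLaw ν₁ P₀.q)
  -- A point mass converts the scalar little-o into an inequality of squares in `ℝ≥0∞`.
  have hlo' : IsLittleOL2 (Measure.dirac ()) (fun θ _ ↦ ‖β θ - β θ₀ - B.mulVec (θ - θ₀)‖)
      (fun θ ↦ θ - θ₀) (𝓝 θ₀) := by
    refine isLittleOL2_of_isLittleO (Eventually.of_forall fun θ ↦ memLp_const _) ?_
    refine hlo.congr' (Eventually.of_forall fun θ ↦ ?_) EventuallyEq.rfl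
    simp
  refine fun ε hε ↦ ?_
  filter_upwards [hlo' (ε / N) (by simp [ENNReal.div_eq_zero_iff, hε, hN2])] with θ hθ
  simp only [enorm_norm, lintegral_dirac] at hθ
  calc _ ≤ N * ‖β θ - β θ₀ - B.mulVec (θ - θ₀)‖ₑ ^ 2 := hbound _
    _ ≤ N * (ε / N * ‖θ - θ₀‖ₑ ^ 2) := by gcongr
    _ = N * (ε / N) * ‖θ - θ₀‖ₑ ^ 2 := (mul_assoc _ _ _).symm
    _ ≤ _ := by gcongr; exact ENNReal.mul_div_le

/-- The mean of a regular submodel is differentiable in `L²`. -/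
theorem isLittleOL2_mean
    (hX : ∀ j, MemLp (fun w : (Fin p → ℝ) × (Fin d → ℝ) => w.1 j) 2 (covLaw ν₁ P₀.q))
    {θ₀ : Fin k → ℝ} {P : (Fin k → ℝ) → Params p d} {B : Matrix (Fin p) (Fin k) ℝ}
    {δ : Fin k → (Fin d → ℝ) → ℝ} (hP : P θ₀ = P₀) (hm₀ : IsAdditive ν₁ P₀.q P₀.m)
    (hadd : ∀ᶠ θ in 𝓝 θ₀, IsAdditive ν₁ P₀.q (P θ).m)
    (hβ : HasFDerivAt (fun θ => (P θ).beta) (Matrix.toLin' B).toContinuousLinearMap θ₀)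
    (hδ : ∀ i, IsAdditive ν₁ P₀.q (δ i))
    (hm : (fun θ => (eLpNorm (fun z => (P θ).m z - P₀.m z - ∑ i, (θ i - θ₀ i) * δ i z) 2
      (zLaw ν₁ P₀.q)).toReal) =o[𝓝 θ₀] fun θ => θ - θ₀) :
    IsLittleOL2 (covLaw ν₁ P₀.q) (fun θ w ↦ (P θ).mean w - P₀.mean w -
      ∑ i, (θ i - θ₀ i) * meanDeriv B δ i w) (fun θ ↦ θ - θ₀) (𝓝 θ₀) := by
  have hsum : ∀ θ : Fin k → ℝ, IsAdditive ν₁ P₀.q (fun z ↦ ∑ i, (θ i - θ₀ i) * δ i z) := fun θ ↦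
    IsAdditive.sum _ fun i _ ↦ (hδ i).const_mul _
  have h1 : IsLittleOL2 (covLaw ν₁ P₀.q) (fun θ w ↦ (P θ).m w.2 - P₀.m w.2 -
      ∑ i, (θ i - θ₀ i) * δ i w.2) (fun θ ↦ θ - θ₀) (𝓝 θ₀) := by
    have h := isLittleOL2_of_isLittleO (by
      filter_upwards [hadd] with θ hθ using (hθ.1.sub hm₀.1).sub (hsum θ).1) hm
    intro ε hε
    filter_upwards [h ε hε, hadd] with θ hθ hθ'
    have hmeas : Measurable fun z ↦ ‖(P θ).m z - P₀.m z - ∑ i, (θ i - θ₀ i) * δ i z‖ₑ ^ 2 :=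
      ((hθ'.measurable.sub hm₀.measurable).sub (hsum θ).measurable).enorm.pow_const 2
    rwa [zLaw, lintegral_map hmeas measurable_snd] at hθ
  have h2 := isLittleOL2_beta hX hβ
  have h3 := IsLittleOL2.add (μ := covLaw ν₁ P₀.q) (F := fun θ w ↦ w.1 ⬝ᵥ ((P θ).beta -
    (P θ₀).beta - B.mulVec (θ - θ₀))) (Eventually.of_forall fun θ ↦
      ((measurable_dotProduct_const _).comp measurable_fst).aemeasurable) h2 h1
  refine h3.congr (fun θ ↦ Eventually.of_forall fun w ↦ ?_) fun _ ↦ rfl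
  have h4 := dotProduct_add_mulVec w.1 0 B (θ - θ₀)
  simp only [zero_add, dotProduct_zero, Pi.sub_apply] at h4
  simp only [hP, dotProduct_sub, h4, Params.mean, meanDeriv, mul_add, Finset.sum_add_distrib]
  ring

/-- The inner products of the score of a regular submodel with the functions `shiftScore P₀ b`. -/
theorem IsRegularSubmodel.integral_score_mul_shiftScore [SigmaFinite ν₁]
    (h𝒬 : ∀ q ∈ 𝒬, IsDensity (covRef d ν₁) q)
    (hP₀ : P₀ ∈ model ν₁ 𝒬)
    (hX : ∀ j, MemLp (fun w : (Fin p → ℝ) × (Fin d → ℝ) => w.1 j) 2 (covLaw ν₁ P₀.q))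
    {θ₀ : Fin k → ℝ} {P : (Fin k → ℝ) → Params p d} {B : Matrix (Fin p) (Fin k) ℝ}
    {s : Fin k → Lp ℝ 2 (P₀.law ν₁)} (h : IsRegularSubmodel ν₁ 𝒬 P₀ θ₀ P B s) :
    ∃ δ : Fin k → (Fin d → ℝ) → ℝ, (∀ i, IsAdditive ν₁ P₀.q (δ i)) ∧
      ∀ i (b : (Fin p → ℝ) × (Fin d → ℝ) → ℝ), Measurable b → MemLp b 2 (covLaw ν₁ P₀.q) →
        ∫ w, s i w * shiftScore P₀ b w ∂(P₀.law ν₁) =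
          fisherInfo P₀.g * ∫ w, meanDeriv B δ i w * b w ∂(covLaw ν₁ P₀.q) := by
  obtain ⟨hP𝒬, hg, hm₀⟩ := hP₀
  have hq := h𝒬 _ hP𝒬
  have hcl : SigmaFinite (covRef d ν₁) := by unfold covRef; infer_instance
  obtain ⟨δ, hδ, hmd⟩ := h.m_diff
  refine ⟨δ, hδ, fun i b hbm hb ↦ ?_⟩
  have hmean := isLittleOL2_mean hX h.through hm₀ h.mem_additive h.beta_diff hδ hmd
  have hgm := hg.isDensity.measurable
  have hψm := measurable_rootDeriv hgm
  have hcm := Params.measurable_mean hm₀.measurable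
  have had : Measurable (meanDeriv B δ i) := measurable_meanDeriv (hδ i).measurable
  have hdm₀ := Params.measurable_density hq.measurable hgm hm₀.measurable
  obtain ⟨κ, ⟨C, hC, hκC⟩, hκ, hψκ, hfκ⟩ := exists_shift_modulus hψm hg.memLp_rootDeriv
    hg.sqrt_sub_sqrt
  -- restriction to the `i`-th coordinate line
  let u : ℝ → Fin k → ℝ := fun t ↦ θ₀ + Pi.single i t
  have hu0 : Tendsto u (𝓝 0) (𝓝 θ₀) := by
    have : Continuous u := continuous_const.add (continuous_single (A := fun _ ↦ ℝ) i)
    simpa [u] using this.tendsto 0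
  have hu : Tendsto u (𝓝[≠] 0) (𝓝 θ₀) := hu0.mono_left nhdsWithin_le_nhds
  have hun : ∀ t, ‖u t - θ₀‖ₑ = ‖t‖ₑ := fun t ↦ by
    rw [← ofReal_norm, ← ofReal_norm]
    simp [u, Pi.norm_single]
  have hus : ∀ t (F : Fin k → ℝ), ∑ j, (u t j - θ₀ j) * F j = t * F i := fun t F ↦ by
    simp [u, Pi.single_apply, ite_mul, Finset.sum_ite_eq']
  have hmodel := hu.eventually h.mem_model
  have haddm := hu.eventually h.mem_additive
  have hmean' : IsLittleOL2 (covLaw ν₁ P₀.q) (fun t w ↦ (P (u t)).mean w - P₀.mean w -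
      t * meanDeriv B δ i w) (fun t : ℝ ↦ t) (𝓝[≠] 0) := by
    refine (hmean.comp_tendsto hu).congr (fun t ↦ Eventually.of_forall fun w ↦ ?_) hun
    simp only [hus]
  have hscore : IsLittleOL2 (obsRef d ν₁) (fun t w ↦ √((P (u t)).density w) - √(P₀.density w) -
      1 / 2 * (t * (s i w * √(P₀.density w)))) (fun t : ℝ ↦ t) (𝓝[≠] 0) := by
    have hsL : ∀ j, MemLp (fun w ↦ s j w * √(P₀.density w)) 2 (obsRef d ν₁) := fun j ↦
      (Lp.memLp (s j)).mul_sqrt_density hq hg hm₀.measurable (Lp.stronglyMeasurable _).measurable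
    have h1 := isLittleOL2_of_isLittleO (by
      filter_upwards [h.mem_model] with θ hθ
      exact ((memLp_sqrt_density (h𝒬 _ hθ.1) hθ.2.1 hθ.2.2.measurable).sub
        (memLp_sqrt_density hq hg hm₀.measurable)).sub ((memLp_finsetSum _ fun j _ ↦
          (hsL j).const_mul (θ j - θ₀ j)).const_mul _)) h.score
    refine (h1.comp_tendsto hu).congr (fun t ↦ Eventually.of_forall fun w ↦ ?_) hun
    simp only [hus]
  -- Reflection about the mean at parameter `u t` turns the residual e of P₀ into −(e − v). As g₀ is
  -- even, √p₀ composed with the reflection is √p₀ with residual shifted by v.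
  let v : ℝ → (Fin p → ℝ) × (Fin d → ℝ) → ℝ := fun t w ↦ 2 * ((P (u t)).mean w - P₀.mean w)
  have hvm : ∀ᶠ t in 𝓝[≠] (0 : ℝ), Measurable (v t) := by
    filter_upwards [haddm] with t ht
    exact ((Params.measurable_mean ht.measurable).sub hcm).const_mul 2
  have hvL : IsLittleOL2 (covLaw ν₁ P₀.q) (fun t w ↦ v t w - t * (2 * meanDeriv B δ i w))
      (fun t : ℝ ↦ t) (𝓝[≠] 0) := by
    refine hmean'.mono (K := 4) (by simp) (Eventually.of_forall fun t ↦ ?_)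
    rw [← lintegral_const_mul' _ _ (by simp)]
    refine lintegral_mono fun w ↦ le_of_eq ?_
    have : v t w - t * (2 * meanDeriv B δ i w) = 2 * ((P (u t)).mean w - P₀.mean w -
      t * meanDeriv B δ i w) := by simp only [v]; ring
    rw [this, enorm_mul, mul_pow]
    congr 1
    rw [← ofReal_norm, ← ENNReal.ofReal_pow (norm_nonneg _)]
    norm_num
  have ht0 : Tendsto (fun t : ℝ ↦ t) (𝓝[≠] 0) (𝓝 0) := nhdsWithin_le_nhds
  have had2 : MemLp (fun w ↦ 2 * meanDeriv B δ i w) 2 (covLaw ν₁ P₀.q) :=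
    (memLp_meanDeriv hX (hδ i)).const_mul 2
  have hvt : Tendsto (fun t ↦ ∫⁻ w, ‖v t w‖ₑ ^ 2 ∂(covLaw ν₁ P₀.q)) (𝓝[≠] 0) (𝓝 0) := by
    have hlim : Tendsto (fun t : ℝ ↦ 2 * ∫⁻ w, ‖v t w - t * (2 * meanDeriv B δ i w)‖ₑ ^ 2
        ∂(covLaw ν₁ P₀.q) + 2 * (‖t‖ₑ ^ 2 * ∫⁻ w, ‖2 * meanDeriv B δ i w‖ₑ ^ 2
        ∂(covLaw ν₁ P₀.q))) (𝓝[≠] 0) (𝓝 0) := by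
      have h1 : Tendsto (fun t : ℝ ↦ ‖t‖ₑ ^ 2) (𝓝[≠] 0) (𝓝 0) := by
        have := (((ENNReal.continuous_pow 2).comp continuous_enorm).tendsto (0 : ℝ)).comp ht0
        simpa [Function.comp_def] using this
      have h2 := ENNReal.Tendsto.mul_const h1 (Or.inr had2.lintegral_sq_ne_top)
      have h3 := (ENNReal.Tendsto.const_mul (a := 2) (hvL.tendsto ht0) (Or.inr (by simp))).add
        (ENNReal.Tendsto.const_mul (a := 2) h2 (Or.inr (by simp)))
      simpa using h3
    refine tendsto_of_tendsto_of_tendsto_of_le_of_le' tendsto_const_nhds hlim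
      (Eventually.of_forall fun _ ↦ zero_le) ?_
    filter_upwards [hvm] with t ht
    have h1 := lintegral_enorm_add_sq_le (μ := covLaw ν₁ P₀.q)
      (F := fun w ↦ v t w - t * (2 * meanDeriv B δ i w))
      (G := fun w ↦ t * (2 * meanDeriv B δ i w)) (by fun_prop)
    simp only [sub_add_cancel] at h1
    refine h1.trans (le_of_eq ?_)
    congr 2
    rw [← lintegral_const_mul' _ _ (by finiteness)]
    simp only [enorm_mul t, mul_pow]
  -- the reflections
  let R : ℝ → ((Fin p → ℝ) × (Fin d → ℝ)) × ℝ → ((Fin p → ℝ) × (Fin d → ℝ)) × ℝ :=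
    fun t w ↦ (w.1, 2 * (P (u t)).mean w.1 - w.2)
  -- The reflection shifts by twice the increment of the mean, which cancels the ½ in the derivative
  -- of a root density; so D has no factor ½.
  let D : ((Fin p → ℝ) × (Fin d → ℝ)) × ℝ → ℝ := fun w ↦
    shiftScore P₀ (meanDeriv B δ i) w * √(P₀.density w)
  let G : ((Fin p → ℝ) × (Fin d → ℝ)) × ℝ → ℝ := fun w ↦ shiftScore P₀ b w * √(P₀.density w)
  have hres : ∀ t w, P₀.resid (R t w) = -(w.2 - P₀.mean w.1 - v t w.1) := fun t w ↦ by
    simp only [R, v, Params.resid_eq]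
    ring
  have hsm : ∀ {c : (Fin p → ℝ) × (Fin d → ℝ) → ℝ}, Measurable c → Measurable (shiftScore P₀ c) :=
    fun hc ↦ (hc.comp measurable_fst).neg.mul (((measurable_deriv _).comp
      (Params.measurable_resid hm₀.measurable)).div (hgm.comp
        (Params.measurable_resid hm₀.measurable)))
  have hkey := integral_score_eq_of_reflection (μ := obsRef d ν₁) (R := R)
    (φ := fun t w ↦ √((P (u t)).density w)) (φ₀ := fun w ↦ √(P₀.density w))
    (S := fun w ↦ s i w * √(P₀.density w)) (D := D) (G := G)
    (by
      filter_upwards [haddm] with t ht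
      exact measurePreserving_sub_snd (covRef d ν₁)
        ((Params.measurable_mean ht.measurable).const_mul 2))
    (fun t w ↦ by simp [R])
    (by
      filter_upwards [hmodel] with t ht
      exact (Params.measurable_density (h𝒬 _ ht.1).measurable ht.2.1.isDensity.measurable
        ht.2.2.measurable).sqrt)
    (by
      filter_upwards [hmodel] with t ht
      exact memLp_sqrt_density (h𝒬 _ ht.1) ht.2.1 ht.2.2.measurable)
    (by
      filter_upwards [hmodel] with t ht w
      have h1 : (P (u t)).resid (R t w) = -(P (u t)).resid w := by
        simp only [R, Params.resid_eq]
        ring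
      simp only [Params.density, h1, ht.2.1.symm]
      rfl)
    hdm₀.sqrt (memLp_sqrt_density hq hg hm₀.measurable)
    ((hsm hbm).mul hdm₀.sqrt)
    ((memLp_shiftScore hq hg hm₀.measurable hbm hb).mul_sqrt_density hq hg hm₀.measurable
      (hsm hbm))
    ((Lp.memLp (s i)).mul_sqrt_density hq hg hm₀.measurable (Lp.stronglyMeasurable _).measurable)
    ((memLp_shiftScore hq hg hm₀.measurable had (memLp_meanDeriv hX (hδ i))).mul_sqrt_density hq hg
      hm₀.measurable (hsm had))
    hscore
    (by
      have h1 := isLittleOL2_shift (ρ := covRef d ν₁) (l := 𝓝[≠] (0 : ℝ)) (r := fun t : ℝ ↦ t)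
        (c := P₀.mean) (f := fun e ↦ √(P₀.g e)) (v := v)
        (L := fun t w ↦ t * (2 * meanDeriv B δ i w)) (h := fun w ↦ 2 * meanDeriv B δ i w)
        hq.measurable hq.nonneg hcm hgm.sqrt hψm hg.memLp_rootDeriv hC hκC hκ hfκ ht0 hvm
        (fun t ↦ by fun_prop) (by fun_prop) had2 (fun t w ↦ (enorm_mul _ _).le) hvL
      rw [← obsRef] at h1
      refine h1.congr (fun t ↦ Eventually.of_forall fun w ↦ ?_) fun _ ↦ rfl
      simp only [D, shiftScore_mul_sqrt_density hq hg]
      simp only [Params.density, hres, hg.symm, Real.sqrt_mul (hq.nonneg _)]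
      simp only [R, Params.resid_eq]
      ring)
    (by
      -- Since `rootDeriv` is odd, G∘R_t is −G with a shifted residual, and it tends to −G in L².
      -- The factor −2 is the one in `shiftScore_mul_sqrt_density`.
      have h1 := tendsto_lintegral_shift (ρ := covRef d ν₁) (l := 𝓝[≠] (0 : ℝ)) (c := P₀.mean)
        (v := v) (b := fun w ↦ -2 * b w) hq.measurable hq.nonneg hcm hψm hC hκC hκ hψκ hvm
        (by fun_prop) (hb.const_mul (-2)) hvt
      rw [← obsRef] at h1
      refine h1.congr fun t ↦ ?_
      congr 1 with w
      congr 2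
      simp only [G, shiftScore_mul_sqrt_density hq hg, hres, hg.rootDeriv_neg]
      simp only [R, Params.resid_eq]
      ring)
  simp only [D, G] at hkey
  rw [integral_mul_sqrt_density hq hg hm₀.measurable,
    integral_mul_sqrt_density hq hg hm₀.measurable,
    integral_shiftScore_mul hq hg hm₀.measurable had hbm] at hkey
  exact hkey

end Necessity

/-! ### The Loewner order and Gram matrices -/

section Gram

theorem Matrix.isClosed_posSemidef (n : Type*) [Fintype n] :
    IsClosed {A : Matrix n n ℝ | A.PosSemidef} := by
  simp only [Matrix.posSemidef_iff_dotProduct_mulVec, Set.ofPred_and, Set.ofPred_forall]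
  refine IsClosed.inter ?_ (isClosed_iInter fun x ↦ ?_)
  · exact isClosed_eq (by fun_prop) continuous_id
  · exact isClosed_le continuous_const (by fun_prop)

theorem Matrix.le_of_tendsto_posSemidef {n ι : Type*} [Fintype n] {l : Filter ι} [l.NeBot]
    {A B : ι → Matrix n n ℝ} {A₀ B₀ : Matrix n n ℝ} (hA : Tendsto A l (𝓝 A₀))
    (hB : Tendsto B l (𝓝 B₀)) (h : ∀ᶠ i in l, A i ≤ B i) : A₀ ≤ B₀ :=
  (Matrix.isClosed_posSemidef n).mem_of_tendsto (hB.sub hA) h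

theorem Matrix.tendsto_inv {n ι : Type*} [Fintype n] [DecidableEq n] {l : Filter ι}
    {A : ι → Matrix n n ℝ} {A₀ : Matrix n n ℝ} (hA : Tendsto A l (𝓝 A₀)) (h : A₀.det ≠ 0) :
    Tendsto (fun i ↦ (A i)⁻¹) l (𝓝 A₀⁻¹) := by
  simp only [Matrix.inv_def, Ring.inverse_eq_inv']
  have h1 : Continuous fun A : Matrix n n ℝ ↦ A.det := continuous_id.matrix_det
  have h2 : Continuous fun A : Matrix n n ℝ ↦ A.adjugate := continuous_id.matrix_adjugate
  exact (((h1.tendsto A₀).comp hA).inv₀ h).smul ((h2.tendsto A₀).comp hA)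

variable {H : Type*} [NormedAddCommGroup H] [InnerProductSpace ℝ H] {m n : Type*}

/-- Each s_i − e_i is orthogonal to all e_j, so the Gram matrix of s is that of e plus that of s −
e. -/
theorem gram_le_gram_of_inner_eq {e s : n → H} [Fintype n]
    (h : ∀ i j, inner ℝ (s i) (e j) = inner ℝ (e i) (e j)) :
    Matrix.gram ℝ e ≤ Matrix.gram ℝ s := by
  rw [Matrix.le_iff]
  convert Matrix.posSemidef_gram ℝ (fun i ↦ s i - e i) using 1
  ext i j
  have h' : inner ℝ (e i) (s j) = inner ℝ (e i) (e j) := by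
    rw [real_inner_comm, h, real_inner_comm]
  simp only [Matrix.sub_apply, Matrix.gram_apply, inner_sub_left, inner_sub_right, h, h']
  ring

/-- By orthogonality ‖s_i − e_i‖² = ‖s_i‖² − ‖e_i‖², and the diagonal entries agree. -/
theorem eq_of_inner_eq_of_gram_eq {e s : n → H}
    (h : ∀ i j, inner ℝ (s i) (e j) = inner ℝ (e i) (e j))
    (hg : Matrix.gram ℝ s = Matrix.gram ℝ e) : s = e := by
  funext i
  rw [← sub_eq_zero, ← inner_self_eq_zero (𝕜 := ℝ)]
  have h1 : inner ℝ (s i) (s i) = inner ℝ (e i) (e i) := congrFun (congrFun hg i) i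
  have h' : inner ℝ (e i) (s i) = inner ℝ (e i) (e i) := by rw [real_inner_comm, h]
  simp only [inner_sub_left, inner_sub_right, h, h', h1]
  ring

/-- The Cramér–Rao inequality. -/
theorem mul_inv_gram_mul_transpose_le [Fintype m] [Fintype n] [DecidableEq m] [DecidableEq n]
    {e : m → H} {s : n → H} {B : Matrix m n ℝ}
    (h : ∀ i j, inner ℝ (e i) (s j) = (Matrix.gram ℝ e * B) i j)
    (he : (Matrix.gram ℝ e).PosDef) (hs : IsUnit (Matrix.gram ℝ s).det) :
    B * (Matrix.gram ℝ s)⁻¹ * B.transpose ≤ (Matrix.gram ℝ e)⁻¹ := by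
  set V := Matrix.gram ℝ e with hV
  set J := Matrix.gram ℝ s with hJ
  have hJp : J.PosDef := (Matrix.posSemidef_gram ℝ s).posDef_iff_isUnit.2
    ((Matrix.isUnit_iff_isUnit_det _).2 hs)
  have hVt : V.transpose = V := by
    simpa [Matrix.conjTranspose_eq_transpose_of_trivial] using he.isHermitian.eq
  have hVu : IsUnit V.det := (Matrix.isUnit_iff_isUnit_det _).1 he.isUnit
  -- By `h` this is the Gram matrix of e and s together. Its Schur complement V − VBJ⁻¹(VB)ᵀ is
  -- positive semidefinite, and conjugation by V⁻¹ gives the inequality.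
  have hblock : (Matrix.fromBlocks V (V * B) (V * B).conjTranspose J).PosSemidef := by
    have h0 : Matrix.fromBlocks V (V * B) (V * B).conjTranspose J =
        Matrix.gram ℝ (Sum.elim e s) := by
      ext (i | i) (j | j)
      · rfl
      · exact (h i j).symm
      · exact (h j i).symm.trans (real_inner_comm _ _)
      · rfl
    rw [h0]
    exact Matrix.posSemidef_gram ℝ _
  have : Invertible J := J.invertibleOfIsUnitDet hs
  have h1 := ((Matrix.PosDef.fromBlocks₂₂ V (V * B) hJp).1 hblock).mul_mul_conjTranspose_same V⁻¹
  have h2 : V⁻¹ * (V - V * B * J⁻¹ * (V * B).conjTranspose) * V⁻¹.conjTranspose =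
      V⁻¹ - B * J⁻¹ * B.transpose := by
    have e1 : V⁻¹ * (V * B * J⁻¹ * (B.transpose * V)) * V⁻¹ =
        (V⁻¹ * V) * (B * J⁻¹ * B.transpose) * (V * V⁻¹) := by simp only [Matrix.mul_assoc]
    rw [Matrix.conjTranspose_eq_transpose_of_trivial, Matrix.conjTranspose_eq_transpose_of_trivial,
      Matrix.transpose_mul, Matrix.transpose_nonsing_inv, hVt, Matrix.mul_sub, Matrix.sub_mul, e1,
      Matrix.nonsing_inv_mul _ hVu, Matrix.mul_nonsing_inv _ hVu, Matrix.one_mul, Matrix.one_mul,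
      Matrix.mul_one]
  rw [Matrix.le_iff, ← h2]
  exact h1

end Gram

/-! ### Scores as a linear image of perturbations of the mean -/

section ScoreMap

variable {p d k : ℕ} {ν₁ : Measure (Fin p → ℝ)} {P₀ : Params p d}

theorem infoMatrix_eq_gram (s : Fin k → Lp ℝ 2 (P₀.law ν₁)) :
    infoMatrix s = Matrix.gram ℝ s := by
  ext i j
  simp [infoMatrix, Matrix.gram_apply, L2.inner_def, mul_comm]

variable [SigmaFinite ν₁]

theorem shiftScore_congr (hq : IsDensity (covRef d ν₁) P₀.q) (hg : IsErrorDensity P₀.g)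
    (hm : Measurable P₀.m) {b b' : (Fin p → ℝ) × (Fin d → ℝ) → ℝ} (h : b =ᵐ[covLaw ν₁ P₀.q] b') :
    shiftScore P₀ b =ᵐ[P₀.law ν₁] shiftScore P₀ b' := by
  filter_upwards [(Params.measurePreserving_fst hq hg hm).quasiMeasurePreserving.ae h] with w hw
  simp only [shiftScore, hw]

/-- The map sending a perturbation of the mean to its score, on `L²`. -/
noncomputable def scoreMap (hq : IsDensity (covRef d ν₁) P₀.q) (hg : IsErrorDensity P₀.g)
    (hm : Measurable P₀.m) : Lp ℝ 2 (covLaw ν₁ P₀.q) →ₗ[ℝ] Lp ℝ 2 (P₀.law ν₁) where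
  toFun b := (memLp_shiftScore hq hg hm (Lp.stronglyMeasurable b).measurable (Lp.memLp b)).toLp _
  map_add' b b' := by
    ext1
    refine (MemLp.coeFn_toLp _).trans (((shiftScore_congr hq hg hm (Lp.coeFn_add b b')).trans
      ?_).trans (Lp.coeFn_add _ _).symm)
    filter_upwards [MemLp.coeFn_toLp (memLp_shiftScore hq hg hm
      (Lp.stronglyMeasurable b).measurable (Lp.memLp b)), MemLp.coeFn_toLp (memLp_shiftScore hq hg hm
      (Lp.stronglyMeasurable b').measurable (Lp.memLp b'))] with w h1 h2
    rw [Pi.add_apply, h1, h2]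
    simp only [shiftScore, Pi.add_apply]
    ring
  map_smul' a b := by
    ext1
    refine (MemLp.coeFn_toLp _).trans (((shiftScore_congr hq hg hm (Lp.coeFn_smul a b)).trans
      ?_).trans (Lp.coeFn_smul _ _).symm)
    filter_upwards [MemLp.coeFn_toLp (memLp_shiftScore hq hg hm
      (Lp.stronglyMeasurable b).measurable (Lp.memLp b))] with w h1
    rw [Pi.smul_apply, RingHom.id_apply, h1]
    simp only [shiftScore, Pi.smul_apply, smul_eq_mul]
    ring

theorem coeFn_scoreMap (hq : IsDensity (covRef d ν₁) P₀.q) (hg : IsErrorDensity P₀.g)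
    (hm : Measurable P₀.m) (b : Lp ℝ 2 (covLaw ν₁ P₀.q)) :
    scoreMap hq hg hm b =ᵐ[P₀.law ν₁] shiftScore P₀ b :=
  MemLp.coeFn_toLp (memLp_shiftScore hq hg hm (Lp.stronglyMeasurable b).measurable (Lp.memLp b))

theorem inner_scoreMap (hq : IsDensity (covRef d ν₁) P₀.q) (hg : IsErrorDensity P₀.g)
    (hm : Measurable P₀.m) (b b' : Lp ℝ 2 (covLaw ν₁ P₀.q)) :
    inner ℝ (scoreMap hq hg hm b) (scoreMap hq hg hm b') = fisherInfo P₀.g * inner ℝ b b' := by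
  have h := integral_shiftScore_mul hq hg hm (Lp.stronglyMeasurable b).measurable
    (Lp.stronglyMeasurable b').measurable
  simp only [L2.inner_def, RCLike.inner_apply, conj_trivial]
  simp_rw [mul_comm (b' _) (b _)]
  rw [← h]
  refine integral_congr_ae ?_
  filter_upwards [coeFn_scoreMap hq hg hm b, coeFn_scoreMap hq hg hm b'] with w h1 h2
  rw [h1, h2, mul_comm]

theorem continuous_scoreMap (hq : IsDensity (covRef d ν₁) P₀.q) (hg : IsErrorDensity P₀.g)
    (hm : Measurable P₀.m) : Continuous (scoreMap hq hg hm) := by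
  refine AddMonoidHomClass.continuous_of_bound (scoreMap hq hg hm) √(fisherInfo P₀.g) fun b ↦ ?_
  rw [norm_eq_sqrt_real_inner, inner_scoreMap, norm_eq_sqrt_real_inner b, ← Real.sqrt_mul]
  exact integral_nonneg fun e ↦ div_nonneg (sq_nonneg _) (hg.isDensity.nonneg e)

end ScoreMap

/-! ### The efficient score in `L²` -/

section Efficient

variable {p d k : ℕ} {ν₁ : Measure (Fin p → ℝ)} {𝒬 : Set ((Fin p → ℝ) × (Fin d → ℝ) → ℝ)}
  {P₀ : Params p d} {q : (Fin p → ℝ) × (Fin d → ℝ) → ℝ}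

/-- The map `h ↦ h(Z)` from `L²` of the law of `Z` to `L²` of the law of `(X, Z)`. -/
noncomputable def compSnd (ν₁ : Measure (Fin p → ℝ)) (q : (Fin p → ℝ) × (Fin d → ℝ) → ℝ) :
    Lp ℝ 2 (zLaw ν₁ q) →ₗᵢ[ℝ] Lp ℝ 2 (covLaw ν₁ q) :=
  Lp.compMeasurePreservingₗᵢ ℝ Prod.snd ⟨measurable_snd, rfl⟩

theorem coeFn_compSnd (h : Lp ℝ 2 (zLaw ν₁ q)) :
    compSnd ν₁ q h =ᵐ[covLaw ν₁ q] fun w ↦ h w.2 :=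
  Lp.coeFn_compMeasurePreserving h ⟨measurable_snd, rfl⟩

theorem compSnd_ae_eq {h : Lp ℝ 2 (zLaw ν₁ q)} {m : (Fin d → ℝ) → ℝ} (hm : h =ᵐ[zLaw ν₁ q] m) :
    compSnd ν₁ q h =ᵐ[covLaw ν₁ q] fun w ↦ m w.2 :=
  (coeFn_compSnd h).trans (ae_of_ae_map measurable_snd.aemeasurable hm)

/-- The covariate `X_j` as an element of `L²`. -/
noncomputable def coordLp
    (hX : ∀ j, MemLp (fun w : (Fin p → ℝ) × (Fin d → ℝ) => w.1 j) 2 (covLaw ν₁ q)) (j : Fin p) :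
    Lp ℝ 2 (covLaw ν₁ q) :=
  (hX j).toLp _

/-- `X_j - η_j(Z)` as an element of `L²`. -/
noncomputable def coordResid
    (hX : ∀ j, MemLp (fun w : (Fin p → ℝ) × (Fin d → ℝ) => w.1 j) 2 (covLaw ν₁ q)) (j : Fin p) :
    Lp ℝ 2 (covLaw ν₁ q) :=
  coordLp hX j - compSnd ν₁ q (eta hX j)

theorem coeFn_coordResid
    (hX : ∀ j, MemLp (fun w : (Fin p → ℝ) × (Fin d → ℝ) => w.1 j) 2 (covLaw ν₁ q)) (j : Fin p) :
    coordResid hX j =ᵐ[covLaw ν₁ q] fun w ↦ w.1 j - eta hX j w.2 := by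
  filter_upwards [Lp.coeFn_sub (coordLp hX j) (compSnd ν₁ q (eta hX j)), (hX j).coeFn_toLp,
    coeFn_compSnd (eta hX j)] with w h1 h2 h3
  rw [coordResid, h1, Pi.sub_apply, coordLp, h2, h3]

/-- The pull-out property of conditional expectation, applied to the factor h(Z). -/
theorem inner_coordLp_compSnd (hq : IsDensity (covRef d ν₁) q)
    (hX : ∀ j, MemLp (fun w : (Fin p → ℝ) × (Fin d → ℝ) => w.1 j) 2 (covLaw ν₁ q)) (j : Fin p)
    (h : Lp ℝ 2 (zLaw ν₁ q)) :
    inner ℝ (coordLp hX j) (compSnd ν₁ q h) =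
      inner ℝ (compSnd ν₁ q ((memLp_regression (hX j)).toLp _)) (compSnd ν₁ q h) := by
  have hprob : IsProbabilityMeasure (covLaw ν₁ q) := hq.isProbabilityMeasure
  have hle : MeasurableSpace.comap (Prod.snd : (Fin p → ℝ) × (Fin d → ℝ) → Fin d → ℝ)
      inferInstance ≤ (inferInstance : MeasurableSpace ((Fin p → ℝ) × (Fin d → ℝ))) :=
    measurable_snd.comap_le
  have hh : MemLp (fun w : (Fin p → ℝ) × (Fin d → ℝ) ↦ h w.2) 2 (covLaw ν₁ q) :=
    (Lp.memLp h).comp_measurePreserving ⟨measurable_snd, rfl⟩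
  have hsm : StronglyMeasurable[MeasurableSpace.comap Prod.snd inferInstance]
      (fun w : (Fin p → ℝ) × (Fin d → ℝ) ↦ h w.2) :=
    (Lp.stronglyMeasurable h).comp_measurable (comap_measurable Prod.snd)
  have hce := condExp_mul_of_stronglyMeasurable_right (μ := covLaw ν₁ q) hsm
    ((hX j).integrable_mul hh) ((hX j).integrable one_le_two)
  have hint := integral_condExp (μ := covLaw ν₁ q) hle
    (f := (fun w : (Fin p → ℝ) × (Fin d → ℝ) ↦ w.1 j) * fun w ↦ h w.2)
  have hreg := (exists_regression ν₁ q j).choose_spec.2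
  rw [integral_congr_ae hce, hreg] at hint
  simp only [L2.inner_def, RCLike.inner_apply, conj_trivial]
  calc _ = ∫ w, w.1 j * h w.2 ∂(covLaw ν₁ q) := by
        refine integral_congr_ae ?_
        filter_upwards [(hX j).coeFn_toLp, coeFn_compSnd h] with w h1 h2
        rw [coordLp, h1, h2, mul_comm]
    _ = ∫ w, regression ν₁ q j w.2 * h w.2 ∂(covLaw ν₁ q) := hint.symm
    _ = _ := by
        refine integral_congr_ae ?_
        filter_upwards [compSnd_ae_eq (memLp_regression (hX j)).coeFn_toLp, coeFn_compSnd h]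
          with w h1 h2
        rw [h1, h2, mul_comm]

theorem eta_mem_closure
    (hX : ∀ j, MemLp (fun w : (Fin p → ℝ) × (Fin d → ℝ) => w.1 j) 2 (covLaw ν₁ q)) (j : Fin p) :
    eta hX j ∈ (additiveSpace ν₁ q).topologicalClosure := by
  have : CompleteSpace (additiveSpace ν₁ q).topologicalClosure :=
    (Submodule.isClosed_topologicalClosure _).completeSpace_coe
  exact Submodule.starProjection_apply_mem _ _

theorem inner_regression_sub_eta
    (hX : ∀ j, MemLp (fun w : (Fin p → ℝ) × (Fin d → ℝ) => w.1 j) 2 (covLaw ν₁ q)) (j : Fin p)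
    {h : Lp ℝ 2 (zLaw ν₁ q)} (hh : h ∈ (additiveSpace ν₁ q).topologicalClosure) :
    inner ℝ ((memLp_regression (hX j)).toLp _ - eta hX j) h = 0 := by
  have : CompleteSpace (additiveSpace ν₁ q).topologicalClosure :=
    (Submodule.isClosed_topologicalClosure _).completeSpace_coe
  exact Submodule.starProjection_inner_eq_zero _ _ hh

/-- X_j − η_j(Z) is the sum of X_j − E(X_j | Z), orthogonal to every square-integrable function of
Z, and E(X_j | Z) − η_j(Z), orthogonal to the closure of H(q) by definition of η_j. -/
theorem inner_coordResid_compSnd (hq : IsDensity (covRef d ν₁) q)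
    (hX : ∀ j, MemLp (fun w : (Fin p → ℝ) × (Fin d → ℝ) => w.1 j) 2 (covLaw ν₁ q)) (j : Fin p)
    {h : Lp ℝ 2 (zLaw ν₁ q)} (hh : h ∈ (additiveSpace ν₁ q).topologicalClosure) :
    inner ℝ (coordResid hX j) (compSnd ν₁ q h) = 0 := by
  have h1 := inner_regression_sub_eta hX j hh
  rw [← (compSnd ν₁ q).inner_map_map, map_sub, inner_sub_left] at h1
  rw [coordResid, inner_sub_left, inner_coordLp_compSnd hq, h1]

variable [SigmaFinite ν₁] (hq : IsDensity (covRef d ν₁) P₀.q) (hg : IsErrorDensity P₀.g)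
  (hm : Measurable P₀.m)
  (hX : ∀ j, MemLp (fun w : (Fin p → ℝ) × (Fin d → ℝ) => w.1 j) 2 (covLaw ν₁ P₀.q))
include hq hg hm hX

/-- The efficient score as an element of `L²(P₀)`. -/
noncomputable def effScoreLp (j : Fin p) : Lp ℝ 2 (P₀.law ν₁) :=
  scoreMap hq hg hm (coordResid hX j)

theorem coeFn_effScoreLp (j : Fin p) :
    effScoreLp hq hg hm hX j =ᵐ[P₀.law ν₁] effScore P₀ hX j := by
  have h1 : effScore P₀ hX j = shiftScore P₀ fun w ↦ w.1 j - eta hX j w.2 := rfl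
  rw [h1]
  exact (coeFn_scoreMap hq hg hm (coordResid hX j)).trans
    (shiftScore_congr hq hg hm (coeFn_coordResid hX j))

theorem infoBound_eq_gram : infoBound P₀ hX = Matrix.gram ℝ (effScoreLp hq hg hm hX) := by
  ext i j
  have hs : ∀ j, Measurable fun w : (Fin p → ℝ) × (Fin d → ℝ) ↦ w.1 j - eta hX j w.2 := fun j ↦
    ((measurable_pi_apply j).comp measurable_fst).sub
      ((Lp.stronglyMeasurable (eta hX j)).measurable.comp measurable_snd)
  have hfst := Params.measurePreserving_fst (ν₁ := ν₁) hq hg hm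
  rw [Matrix.gram_apply, effScoreLp, effScoreLp, inner_scoreMap]
  simp only [infoBound, Matrix.smul_apply, Matrix.of_apply, smul_eq_mul, L2.inner_def,
    RCLike.inner_apply, conj_trivial]
  congr 1
  calc _ = ∫ w, (w.1 i - eta hX i w.2) * (w.1 j - eta hX j w.2) ∂(covLaw ν₁ P₀.q) := by
        have h1 := integral_map hfst.aemeasurable (f := fun w : (Fin p → ℝ) × (Fin d → ℝ) ↦
          (w.1 i - eta hX i w.2) * (w.1 j - eta hX j w.2))
          ((hs i).mul (hs j)).aestronglyMeasurable
        rw [hfst.map_eq] at h1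
        exact h1.symm
    _ = _ := by
        refine integral_congr_ae ?_
        filter_upwards [coeFn_coordResid hX i, coeFn_coordResid hX j] with w h1 h2
        rw [h1, h2, mul_comm]

/-- The inner products of the score of a regular submodel with the efficient score. -/
theorem IsRegularSubmodel.inner_effScoreLp (h𝒬 : ∀ q ∈ 𝒬, IsDensity (covRef d ν₁) q)
    (hP₀ : P₀ ∈ model ν₁ 𝒬) {θ₀ : Fin k → ℝ} {P : (Fin k → ℝ) → Params p d}
    {B : Matrix (Fin p) (Fin k) ℝ} {s : Fin k → Lp ℝ 2 (P₀.law ν₁)}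
    (h : IsRegularSubmodel ν₁ 𝒬 P₀ θ₀ P B s) (i : Fin k) (j : Fin p) :
    inner ℝ (s i) (effScoreLp hq hg hm hX j) =
      ∑ l, B l i * inner ℝ (effScoreLp hq hg hm hX l) (effScoreLp hq hg hm hX j) := by
  obtain ⟨δ, hδ, hs⟩ := h.integral_score_mul_shiftScore h𝒬 hP₀ hX
  let δ' : Lp ℝ 2 (zLaw ν₁ P₀.q) := (hδ i).1.toLp _
  have hδ' : δ' ∈ additiveSpace ν₁ P₀.q := ⟨δ i, hδ i, (hδ i).1.coeFn_toLp⟩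
  have h1 := hs i (coordResid hX j) (Lp.stronglyMeasurable _).measurable (Lp.memLp _)
  have h2 : inner ℝ (s i) (effScoreLp hq hg hm hX j) =
      ∫ w, s i w * shiftScore P₀ (coordResid hX j) w ∂(P₀.law ν₁) := by
    rw [L2.inner_def]
    refine integral_congr_ae ?_
    filter_upwards [coeFn_scoreMap hq hg hm (coordResid hX j)] with w hw
    rw [effScoreLp, hw]
    simp [mul_comm]
  let M : Lp ℝ 2 (covLaw ν₁ P₀.q) := (memLp_meanDeriv (B := B) hX (hδ i)).toLp _
  have h3 : ∫ w, meanDeriv B δ i w * coordResid hX j w ∂(covLaw ν₁ P₀.q) =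
      inner ℝ M (coordResid hX j) := by
    rw [L2.inner_def]
    refine integral_congr_ae ?_
    filter_upwards [(memLp_meanDeriv (B := B) hX (hδ i)).coeFn_toLp] with w hw
    simp only [M, hw]
    simp [mul_comm]
  have h4 : M = ∑ l, B l i • coordLp hX l + compSnd ν₁ P₀.q δ' := by
    ext1
    have e1 : ∀ᵐ w ∂(covLaw ν₁ P₀.q), ∀ l, (B l i • coordLp hX l : Lp ℝ 2 (covLaw ν₁ P₀.q)) w =
        B l i * w.1 l := ae_all_iff.2 fun l ↦ by
      filter_upwards [Lp.coeFn_smul (B l i) (coordLp hX l), (hX l).coeFn_toLp] with w h1 h2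
      rw [h1, Pi.smul_apply, coordLp, h2, smul_eq_mul]
    filter_upwards [(memLp_meanDeriv (B := B) hX (hδ i)).coeFn_toLp, e1,
      Lp.coeFn_add (∑ l, B l i • coordLp hX l) (compSnd ν₁ P₀.q δ'),
      Lp.coeFn_finsetSum Finset.univ (fun l ↦ B l i • coordLp hX l),
      compSnd_ae_eq (hδ i).1.coeFn_toLp] with w h1 h2 h3 h4 h5
    rw [h3, Pi.add_apply, h4, h5, Finset.sum_apply]
    simp only [M, h1, h2, meanDeriv, mul_comm]
  -- The left factors differ by η_l(Z), which the right factor annihilates; the term δ_i(Z)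
  -- disappears below for the same reason.
  have h5 : ∀ l, inner ℝ (coordLp hX l) (coordResid hX j) =
      inner ℝ (coordResid hX l) (coordResid hX j) := fun l ↦ by
    have e : coordLp hX l = coordResid hX l + compSnd ν₁ P₀.q (eta hX l) :=
      (sub_add_cancel _ _).symm
    rw [e, inner_add_left, real_inner_comm _ (compSnd ν₁ P₀.q _),
      inner_coordResid_compSnd hq hX j (eta_mem_closure hX l), add_zero]
  rw [h2, h1, h3, h4, inner_add_left, real_inner_comm _ (compSnd ν₁ P₀.q _),
    inner_coordResid_compSnd hq hX j (Submodule.le_topologicalClosure _ hδ'), add_zero, sum_inner,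
    Finset.mul_sum]
  refine Finset.sum_congr rfl fun l _ ↦ ?_
  rw [real_inner_smul_left, h5, effScoreLp, effScoreLp, inner_scoreMap]
  ring

/-- The submodel with mean `xᵀb + m⁰(z) - (b - β⁰)ᵀm(z)`. -/
theorem isBetaSubmodel_of_isAdditive (hP₀ : P₀ ∈ model ν₁ 𝒬) {m : Fin p → (Fin d → ℝ) → ℝ}
    (hma : ∀ j, IsAdditive ν₁ P₀.q (m j)) {h : Fin p → Lp ℝ 2 (zLaw ν₁ P₀.q)}
    (hh : ∀ j, h j =ᵐ[zLaw ν₁ P₀.q] m j) :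
    IsBetaSubmodel ν₁ 𝒬 P₀
      (fun b ↦ { P₀ with
        beta := b
        m := fun z ↦ P₀.m z + ∑ i, (b i - P₀.beta i) * (-1 * m i z) })
      (fun j ↦ scoreMap hq hg hm (coordLp hX j - compSnd ν₁ P₀.q (h j))) := by
  refine ⟨fun b ↦ rfl, isRegularSubmodel_of_linear hP₀ hq hX (fun i ↦ (hma i).const_mul (-1))
    (fun b ↦ by simp) fun j ↦ (coeFn_scoreMap hq hg hm _).trans (shiftScore_congr hq hg hm ?_)⟩
  filter_upwards [Lp.coeFn_sub (coordLp hX j) (compSnd ν₁ P₀.q (h j)), (hX j).coeFn_toLp,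
    compSnd_ae_eq (hh j)] with w h1 h2 h3
  rw [h1, Pi.sub_apply, coordLp, h2, h3, meanDeriv]
  simp [Matrix.one_apply, sub_eq_add_neg]

theorem exists_isBetaSubmodel (hP₀ : P₀ ∈ model ν₁ 𝒬) {h : Fin p → Lp ℝ 2 (zLaw ν₁ P₀.q)}
    (hh : ∀ j, h j ∈ additiveSpace ν₁ P₀.q) :
    ∃ P, IsBetaSubmodel ν₁ 𝒬 P₀ P
      (fun j ↦ scoreMap hq hg hm (coordLp hX j - compSnd ν₁ P₀.q (h j))) := by
  choose m hma hhm using hh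
  exact ⟨_, isBetaSubmodel_of_isAdditive hq hg hm hX hP₀ hma hhm⟩

theorem isBetaSubmodel_of_fixed (hP₀ : P₀ ∈ model ν₁ 𝒬) :
    IsBetaSubmodel ν₁ 𝒬 P₀ (fun b => { P₀ with beta := b })
      (fun j ↦ scoreMap hq hg hm (coordLp hX j)) := by
  have h := isBetaSubmodel_of_isAdditive (𝒬 := 𝒬) hq hg hm hX hP₀ (m := fun _ _ ↦ 0)
    (h := fun _ ↦ 0) (fun _ ↦ isAdditive_zero) (fun _ ↦ Lp.coeFn_zero _ _ _)
  simpa using h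

/-- For h in H(q₀), moving m alone in direction h gives this score; continuity of the score map
reaches the closure. -/
theorem scoreMap_compSnd_mem_nuisance (hP₀ : P₀ ∈ model ν₁ 𝒬) {h : Lp ℝ 2 (zLaw ν₁ P₀.q)}
    (hh : h ∈ (additiveSpace ν₁ P₀.q).topologicalClosure) :
    scoreMap hq hg hm (compSnd ν₁ P₀.q h) ∈ nuisanceTangentSpace ν₁ 𝒬 P₀ := by
  have hc := Continuous.comp (continuous_scoreMap hq hg hm) (compSnd ν₁ P₀.q).continuous
  refine map_mem_closure (f := fun h ↦ scoreMap hq hg hm (compSnd ν₁ P₀.q h)) hc hh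
    fun f hf ↦ Submodule.subset_span ?_
  obtain ⟨m, hma, hfm⟩ := hf
  refine ⟨fun t ↦ { P₀ with m := fun z ↦ P₀.m z + ∑ i, (t i - (0 : Fin 1 → ℝ) i) * m z },
    fun _ ↦ scoreMap hq hg hm (compSnd ν₁ P₀.q f), fun t ↦ rfl,
    isRegularSubmodel_of_linear hP₀ hq hX (δ := fun _ ↦ m) (fun _ ↦ hma) (fun t ↦ by simp)
      fun i ↦ (coeFn_scoreMap hq hg hm _).trans (shiftScore_congr hq hg hm ?_), rfl⟩
  filter_upwards [compSnd_ae_eq hfm] with w hw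
  simp [hw, meanDeriv]

/-- The case B = 0 of the inner product identity; an orthogonal complement is closed, so it absorbs
the closed span. -/
theorem inner_nuisance_effScoreLp (h𝒬 : ∀ q ∈ 𝒬, IsDensity (covRef d ν₁) q)
    (hP₀ : P₀ ∈ model ν₁ 𝒬) (j : Fin p) {f : Lp ℝ 2 (P₀.law ν₁)}
    (hf : f ∈ nuisanceTangentSpace ν₁ 𝒬 P₀) : inner ℝ (effScoreLp hq hg hm hX j) f = 0 := by
  have h1 : nuisanceTangentSpace ν₁ 𝒬 P₀ ≤ (ℝ ∙ effScoreLp hq hg hm hX j)ᗮ := by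
    refine Submodule.topologicalClosure_minimal _ (Submodule.span_le.2 ?_)
      (Submodule.isClosed_orthogonal _)
    rintro _ ⟨P, s, -, h, rfl⟩
    rw [SetLike.mem_coe, Submodule.mem_orthogonal_singleton_iff_inner_left,
      h.inner_effScoreLp hq hg hm hX h𝒬 hP₀]
    simp
  exact Submodule.mem_orthogonal_singleton_iff_inner_right.1 (h1 hf)

/-- The score for β splits into the score of X_j − η_j(Z) and that of η_j(Z). The latter lies in the
nuisance tangent space and the former is orthogonal to it, so the latter is the projection. -/
theorem isEfficientScore_effScore (h𝒬 : ∀ q ∈ 𝒬, IsDensity (covRef d ν₁) q)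
    (hP₀ : P₀ ∈ model ν₁ 𝒬) : IsEfficientScore ν₁ 𝒬 P₀ (effScore P₀ hX) := by
  refine ⟨_, isBetaSubmodel_of_fixed hq hg hm hX hP₀, fun j ↦ ?_⟩
  have h1 : scoreMap hq hg hm (coordLp hX j) - scoreMap hq hg hm (compSnd ν₁ P₀.q (eta hX j)) =
      effScoreLp hq hg hm hX j := by
    rw [← map_sub]
    rfl
  have h2 : (nuisanceTangentSpace ν₁ 𝒬 P₀).starProjection (scoreMap hq hg hm (coordLp hX j)) =
      scoreMap hq hg hm (compSnd ν₁ P₀.q (eta hX j)) := by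
    refine Submodule.eq_starProjection_of_mem_of_inner_eq_zero
      (scoreMap_compSnd_mem_nuisance hq hg hm hX hP₀ (eta_mem_closure hX j)) fun f hf ↦ ?_
    rw [h1]
    exact inner_nuisance_effScoreLp hq hg hm hX h𝒬 hP₀ j hf
  rw [h2, h1]
  exact (coeFn_effScoreLp hq hg hm hX j).symm

theorem IsBetaSubmodel.inner_effScoreLp (h𝒬 : ∀ q ∈ 𝒬, IsDensity (covRef d ν₁) q)
    (hP₀ : P₀ ∈ model ν₁ 𝒬) {P : (Fin p → ℝ) → Params p d} {s : Fin p → Lp ℝ 2 (P₀.law ν₁)}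
    (h : IsBetaSubmodel ν₁ 𝒬 P₀ P s) (i j : Fin p) :
    inner ℝ (s i) (effScoreLp hq hg hm hX j) =
      inner ℝ (effScoreLp hq hg hm hX i) (effScoreLp hq hg hm hX j) := by
  rw [h.2.inner_effScoreLp hq hg hm hX h𝒬 hP₀]
  simp [Matrix.one_apply]

/-! ### Information bounds for β. -/

theorem infoBound_mem_lowerBounds (h𝒬 : ∀ q ∈ 𝒬, IsDensity (covRef d ν₁) q)
    (hP₀ : P₀ ∈ model ν₁ 𝒬) : infoBound P₀ hX ∈ lowerBounds (betaInfos ν₁ 𝒬 P₀) := by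
  rintro _ ⟨P, s, h, rfl⟩
  rw [infoBound_eq_gram hq hg hm hX, infoMatrix_eq_gram]
  exact gram_le_gram_of_inner_eq (h.inner_effScoreLp hq hg hm hX h𝒬 hP₀)

/-- There are regular submodels indexed by `β` whose information matrices converge to the bound. -/
theorem exists_tendsto_infoBound (hP₀ : P₀ ∈ model ν₁ 𝒬) :
    ∃ (P : ℕ → (Fin p → ℝ) → Params p d) (s : ℕ → Fin p → Lp ℝ 2 (P₀.law ν₁)),
      (∀ n, IsBetaSubmodel ν₁ 𝒬 P₀ (P n) (s n)) ∧
      Tendsto (fun n ↦ infoMatrix (s n)) atTop (𝓝 (infoBound P₀ hX)) := by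
  have h1 : ∀ j, ∃ u : ℕ → Lp ℝ 2 (zLaw ν₁ P₀.q), (∀ n, u n ∈ additiveSpace ν₁ P₀.q) ∧
      Tendsto u atTop (𝓝 (eta hX j)) := fun j ↦
    mem_closure_iff_seq_limit.1 (eta_mem_closure hX j)
  choose u hu hut using h1
  choose P hP using fun n ↦ exists_isBetaSubmodel hq hg hm hX hP₀ (fun j ↦ hu j n)
  refine ⟨P, _, hP, ?_⟩
  have h2 : ∀ j, Tendsto (fun n ↦ scoreMap hq hg hm (coordLp hX j - compSnd ν₁ P₀.q (u j n))) atTop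
      (𝓝 (effScoreLp hq hg hm hX j)) := fun j ↦
    ((continuous_scoreMap hq hg hm).tendsto _).comp
      (tendsto_const_nhds.sub (((compSnd ν₁ P₀.q).continuous.tendsto _).comp (hut j)))
  rw [infoBound_eq_gram hq hg hm hX]
  simp only [infoMatrix_eq_gram]
  exact tendsto_pi_nhds.2 fun i ↦ tendsto_pi_nhds.2 fun j ↦ (h2 i).inner (h2 j)

/-- Attainment is not guaranteed when some η_j is outside H(q₀), but information matrices converge
to the bound and the Loewner order is closed. -/
theorem isGLB_infoBound (h𝒬 : ∀ q ∈ 𝒬, IsDensity (covRef d ν₁) q)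
    (hP₀ : P₀ ∈ model ν₁ 𝒬) : IsGLB (betaInfos ν₁ 𝒬 P₀) (infoBound P₀ hX) := by
  refine ⟨infoBound_mem_lowerBounds hq hg hm hX h𝒬 hP₀, fun M hM ↦ ?_⟩
  obtain ⟨P, s, hs, ht⟩ := exists_tendsto_infoBound hq hg hm hX hP₀
  exact Matrix.le_of_tendsto_posSemidef tendsto_const_nhds ht
    (Eventually.of_forall fun n ↦ hM ⟨_, _, hs n, rfl⟩)

/-- Cramér–Rao gives the upper bound. For minimality, the information matrices converging to the
bound have an invertible limit, so they are eventually invertible and their inverses converge. -/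
theorem isLUB_inv_infoBound (h𝒬 : ∀ q ∈ 𝒬, IsDensity (covRef d ν₁) q)
    (hP₀ : P₀ ∈ model ν₁ 𝒬) (hpos : (infoBound P₀ hX).PosDef) :
    IsLUB (inverseInfos ν₁ 𝒬 P₀) (infoBound P₀ hX)⁻¹ := by
  constructor
  · rintro _ ⟨k, θ₀, P, B, s, h, hs, rfl⟩
    rw [infoMatrix_eq_gram] at hs ⊢
    rw [infoBound_eq_gram hq hg hm hX] at hpos ⊢
    refine mul_inv_gram_mul_transpose_le (fun i j ↦ ?_) hpos hs
    rw [real_inner_comm, h.inner_effScoreLp hq hg hm hX h𝒬 hP₀, Matrix.mul_apply]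
    refine Finset.sum_congr rfl fun l _ ↦ ?_
    rw [Matrix.gram_apply, real_inner_comm, mul_comm]
  · intro M hM
    obtain ⟨P, s, hs, ht⟩ := exists_tendsto_infoBound hq hg hm hX hP₀
    have hdet : (infoBound P₀ hX).det ≠ 0 := hpos.det_pos.ne'
    have hcont : Continuous fun A : Matrix (Fin p) (Fin p) ℝ ↦ A.det := continuous_id.matrix_det
    have hev := ((hcont.tendsto _).comp ht).eventually_ne hdet
    refine Matrix.le_of_tendsto_posSemidef (Matrix.tendsto_inv ht hdet) tendsto_const_nhds ?_
    filter_upwards [hev] with n hn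
    exact hM ⟨p, P₀.beta, P n, 1, s n, (hs n).2, isUnit_iff_ne_zero.2 hn, by simp⟩

end Efficient

theorem theorem1 {p d : ℕ} (ν₁ : Measure (Fin p → ℝ)) [SigmaFinite ν₁]
    (𝒬 : Set ((Fin p → ℝ) × (Fin d → ℝ) → ℝ)) (h𝒬 : ∀ q ∈ 𝒬, IsDensity (covRef d ν₁) q)
    (P₀ : Params p d) (hP₀ : P₀ ∈ model ν₁ 𝒬)
    (hX : ∀ j, MemLp (fun w : (Fin p → ℝ) × (Fin d → ℝ) => w.1 j) 2 (covLaw ν₁ P₀.q)) :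
    -- the efficient score, as residual of the projection onto the nuisance tangent space
    IsEfficientScore ν₁ 𝒬 P₀ (effScore P₀ hX) ∧
    -- the efficient score is the score in the least favorable submodel, which exists as soon as
    -- the projections lie in `H(q₀)` (automatic when `H(q₀)` is closed)
    ((∀ j, eta hX j ∈ additiveSpace ν₁ P₀.q) →
      ∃ P s, IsLeastFavorable ν₁ 𝒬 P₀ P s ∧ ∀ j, s j =ᵐ[P₀.law ν₁] effScore P₀ hX j) ∧
    (∀ P s, IsLeastFavorable ν₁ 𝒬 P₀ P s → ∀ j, s j =ᵐ[P₀.law ν₁] effScore P₀ hX j) ∧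
    -- the information bound
    IsGLB (betaInfos ν₁ 𝒬 P₀) (infoBound P₀ hX) ∧
    ((infoBound P₀ hX).PosDef → IsLUB (inverseInfos ν₁ 𝒬 P₀) (infoBound P₀ hX)⁻¹) := by
  have hq := h𝒬 _ hP₀.1
  have hg := hP₀.2.1
  have hm := hP₀.2.2.measurable
  have hglb := isGLB_infoBound hq hg hm hX h𝒬 hP₀
  refine ⟨isEfficientScore_effScore hq hg hm hX h𝒬 hP₀, fun hη ↦ ?_, fun P s hs j ↦ ?_, hglb,
    isLUB_inv_infoBound hq hg hm hX h𝒬 hP₀⟩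
  · obtain ⟨P, hP⟩ := exists_isBetaSubmodel hq hg hm hX hP₀ hη
    have hinfo : infoMatrix (effScoreLp hq hg hm hX) = infoBound P₀ hX := by
      rw [infoMatrix_eq_gram, infoBound_eq_gram hq hg hm hX]
    refine ⟨P, effScoreLp hq hg hm hX, ⟨hP, ⟨P, _, hP, rfl⟩, ?_⟩, coeFn_effScoreLp hq hg hm hX⟩
    rw [hinfo]
    exact hglb.1
  -- A least element is a greatest lower bound, so s and ℓ* have the same Gram matrix, which forces
  -- s = ℓ*.
  · have hinfo : infoMatrix s = infoBound P₀ hX := hs.2.isGLB.unique hglb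
    rw [infoMatrix_eq_gram, infoBound_eq_gram hq hg hm hX] at hinfo
    rw [eq_of_inner_eq_of_gram_eq (hs.1.inner_effScoreLp hq hg hm hX h𝒬 hP₀) hinfo]
    exact coeFn_effScoreLp hq hg hm hX j
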